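/- Let $\alpha,\beta\in\mathbb R$ with $\beta>0$ and either $0\le\alpha<1/2$, or $\alpha=1/2$ and $\beta\ge 1/2$. Put $\Omega=[0,\alpha)\cup[\beta+\alpha,\beta+1)$ and $g=\chi_\Omega$. For $\lambda=(t,\nu)\in\mathbb R^2$ let $g_\lambda(x)=g(x-t)e^{2\pi i x\nu}$, let $$V_gg(t,\nu)=\int_{\mathbb R} g(x)\overline{g(x-t)}e^{-2\pi i x\nu}\,dx$$ be the short time Fourier transform of $g$ with window $g$, and let $\mathcal Z(V_gg)=\{(t,\nu)\in\mathbb R^2: V_gg(t,\nu)=0\}$. Define $D\subset\mathbb R^2$ by $$D=\Omega\times[0,1)\qquad\text{if }\alpha<1/2,$$ and, if $\alpha=1/2$, by $$D=\begin{cases}\displaystyle\Omega\times\bigcup_{k=0}^{2\beta}\Big[\tfrac{2k}{2\beta+1},\tfrac{2k+1}{2\beta+1}\Big)&\text{if }\beta\in\frac12\mathbb N,\\[2ex]\displaystyle\Omega\times\Big(\bigcup_{k=0}^{\lfloor2\beta\rfloor}\Big[\tfrac{2k}{2\beta+1},\tfrac{2k+1}{2\beta+1}\Big)\cup\Big[\tfrac{2(\lfloor2\beta\rfloor+1)}{2\beta+1},\tfrac{2(\lfloor2\beta\rfloor+1)+\{2\beta\}}{2\beta+1}\Big)\Big)&\text{if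 }\beta\notin\frac12\mathbb N,\end{cases}$$ where $\lfloor x\rfloor$ is the integer part of $x$ and $\{x\}=x-\lfloor x\rfloor$. Let $\Lambda\subseteq\mathbb R^2$. Then $\{g_\lambda\}_{\lambda\in\Lambda}$ is an orthonormal basis of $L^2(\mathbb R)$ if and only if both of the following conditions hold: (i) $\Lambda-\Lambda\subseteq\mathcal Z(V_gg)\cup\{0\}$; (ii) $D$ tiles $\mathbb R^2$ with translation set $\Lambda$, that is, $\sum_{\lambda\in\Lambda}\chi_D(x-\lambda)=1$ for almost every $x\in\mathbb R^2$. -/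

import Mathlib

open MeasureTheory
open scoped ENNReal Pointwise ComplexConjugate

noncomputable section

namespace TwoIntervalGabor

/-- The time-frequency shift `g_(t,ν)(x) = g(x - t) e^{2π i x ν}`. -/
def tfShift (g : ℝ → ℂ) (p : ℝ × ℝ) : ℝ → ℂ :=
  fun x => g (x - p.1) * Complex.exp (2 * Real.pi * Complex.I * (x * p.2 : ℝ))

/-- The Gabor system `{g_p : p ∈ Λ}` is an orthonormal basis of `L²(ℝ)`: there is a Hilbert basis
of `L²(ℝ)` indexed by `Λ` whose member at `p` is the class of the function `g_p`. -/
def IsGaborONB (g : ℝ → ℂ) (Λ : Set (ℝ × ℝ)) : Prop :=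
  ∃ b : HilbertBasis Λ ℂ (Lp ℂ 2 (volume : Measure ℝ)),
    ∀ p : Λ, ⇑(b p) =ᵐ[volume] tfShift g p

/-- The short time Fourier transform
`V_g f(t,ν) = ∫ f(x) conj(g(x - t)) e^{-2π i x ν} dx`. -/
def stft (g f : ℝ → ℂ) (p : ℝ × ℝ) : ℂ :=
  ∫ x : ℝ, f x * conj (g (x - p.1)) * Complex.exp (-(2 * Real.pi * Complex.I * (x * p.2 : ℝ)))

/-- The zero set of `V_g g`. -/
def zeroSet (g : ℝ → ℂ) : Set (ℝ × ℝ) := {p | stft g g p = 0}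

/-- `D + Λ = ℝ²` in the sense of tilings: `∑_{p ∈ Λ} χ_D(x - p) = 1` for almost every `x`. -/
def Tiles (D Λ : Set (ℝ × ℝ)) : Prop :=
  ∀ᵐ x : ℝ × ℝ, ∑' p : Λ, D.indicator (fun _ => (1 : ℝ≥0∞)) (x - p) = 1

/-- `Ω = [0, α) ∪ [β + α, β + 1)`. -/
def Omega (α β : ℝ) : Set ℝ := Set.Ico 0 α ∪ Set.Ico (β + α) (β + 1)

/-- The complex-valued characteristic function of a set. -/
def chi (S : Set ℝ) : ℝ → ℂ := S.indicator fun _ => 1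

/-- `⋃_{k=0}^{⌊2β⌋} [2k/(2β+1), (2k+1)/(2β+1))`. -/
def fullBlocks (β : ℝ) : Set ℝ :=
  ⋃ k ∈ Finset.range (⌊2 * β⌋₊ + 1),
    Set.Ico (2 * (k : ℝ) / (2 * β + 1)) ((2 * (k : ℝ) + 1) / (2 * β + 1))

/-- The thinner block
`[2(⌊2β⌋+1)/(2β+1), (2(⌊2β⌋+1)+{2β})/(2β+1))`, where `{x}` is the fractional part. -/
def thinBlock (β : ℝ) : Set ℝ :=
  Set.Ico (2 * ((⌊2 * β⌋ : ℝ) + 1) / (2 * β + 1))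
    ((2 * ((⌊2 * β⌋ : ℝ) + 1) + Int.fract (2 * β)) / (2 * β + 1))

open Classical in
/-- The region `D`: it is `Ω × [0,1)` if `α < 1/2`; otherwise (for `α = 1/2`) it is the product of
`Ω` with the full blocks if `β ∈ ½ℕ`, and of `Ω` with all the blocks if `β ∉ ½ℕ`. -/
def region (α β : ℝ) : Set (ℝ × ℝ) :=
  if α < 1 / 2 then Omega α β ×ˢ Set.Ico (0 : ℝ) 1
  else if ∃ n : ℕ, β = (n : ℝ) / 2 then Omega α β ×ˢ fullBlocks β
  else Omega α β ×ˢ (fullBlocks β ∪ thinBlock β)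

end TwoIntervalGabor

end

/-! Write `V = stft g g`, `g = chi Ω`. Moyal's identity, which is Plancherel in `ν` followed by
Tonelli, gives `∫ |V|² = |Ω|² = 1`. Since `|⟨g_p, g_z⟩| = |V(z - p)|`, Bessel's inequality says that
`|V|²` packs with translation set `Λ` when the system is orthonormal, and Parseval's identity says
that it tiles when the system is a basis. Between two functions of integral one, tiling passes from
one to the other as soon as the other packs (`tiles_of_tiles_of_packs`).

For "if", `D` has area one and tiles, so `|V|²` tiles and Parseval holds at almost every `g_z`. A
vector `f` orthogonal to the system is then orthogonal to almost every `g_z`, and Moyal gives `f =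
0`. This uses only that `D` has area one.

For "only if", `|V|²` tiles, and `D` must be shown to pack. It does when `D` meets its translates by
nonzero zeros of `V` only in null sets (`IsOrthPacking`). At low frequencies the zeros over `Ω - Ω`
are few (`stft_Omega_eq_zero_cases`), because `V(t, ·)` is the Fourier transform of the indicator of
the overlap of `Ω` and `Ω + t`, a union of at most three intervals. They miss the differences of `D`
except in two parameter ranges with `α < 1/2`. There some other packing region has area greater than
one, which rules out every basis, and by "if" also every `Λ` satisfying (i) and (ii): the
equivalence holds with both sides false. -/

namespace TwoIntervalGabor

/-! ### Plancherel's theorem for the Fourier integral on `L¹ ∩ L²`. -/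

section Plancherel

open FourierTransform SchwartzMap
open scoped ContDiff

/-- On `L¹ ∩ L²` the `L²`-Fourier transform is given by the Fourier integral. -/
theorem fourier_toLp_ae_eq {f : ℝ → ℂ} (h1 : Integrable f) (h2 : MemLp f 2) :
    ((𝓕 (h2.toLp f) : Lp (α := ℝ) ℂ 2) : ℝ → ℂ) =ᵐ[volume] 𝓕 f := by
  have hcont : Continuous (𝓕 f) :=
    VectorFourier.fourierIntegral_continuous Real.continuous_fourierChar
      (innerSL ℝ).continuous₂ h1
  refine ae_eq_of_integral_contDiff_smul_eq
    ((Lp.memLp (μ := volume) (𝓕 (h2.toLp f))).locallyIntegrable one_le_two) hcont.locallyIntegrable fun φ hφ hφc => ?_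
  have hg₁ : HasCompactSupport (Complex.ofRealCLM ∘ φ) := hφc.comp_left rfl
  have hg₂ : ContDiff ℝ ∞ (Complex.ofRealCLM ∘ φ) := by fun_prop
  set s : 𝓢(ℝ, ℂ) := hg₁.toSchwartzMap hg₂ with hs
  have hsφ : ∀ x, s x = (φ x : ℂ) := fun x => by simp [hs]
  -- Both transforms are compared as tempered distributions: on each side the Fourier transform
  -- moves onto the test function `s`.
  have key : (∫ x, s x • (𝓕 (h2.toLp f : Lp (α := ℝ) ℂ 2) : Lp (α := ℝ) ℂ 2) x) = ∫ x, s x • 𝓕 f x := by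
    rw [← Lp.toTemperedDistribution_apply (μ := volume), ← Lp.fourier_toTemperedDistribution_eq,
      TemperedDistribution.fourier_apply, Lp.toTemperedDistribution_apply]
    have e1 : ∫ x, (𝓕 s) x • (h2.toLp f) x = ∫ x, (𝓕 s) x • f x :=
      integral_congr_ae (by filter_upwards [h2.coeFn_toLp] with x hx; rw [hx])
    rw [e1, SchwartzMap.fourier_coe]
    have := VectorFourier.integral_fourierIntegral_smul_eq_flip (μ := volume) (ν := volume)
      (L := innerₗ ℝ) (f := (s : ℝ → ℂ)) (g := f) Real.continuous_fourierChar
      (by exact continuous_inner) s.integrable h1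
    rw [flip_innerₗ] at this
    exact this
  simpa [hsφ] using key

/-- Plancherel's theorem on `L¹ ∩ L²`. -/
theorem lintegral_enorm_fourier_sq {f : ℝ → ℂ} (h1 : Integrable f) (h2 : MemLp f 2) :
    ∫⁻ ν, ‖𝓕 f ν‖ₑ ^ 2 = ∫⁻ x, ‖f x‖ₑ ^ 2 := by
  have key : eLpNorm (𝓕 f) 2 = eLpNorm f 2 := by
    rw [← eLpNorm_congr_ae (fourier_toLp_ae_eq h1 h2), ← eLpNorm_congr_ae h2.coeFn_toLp,
      ← Lp.enorm_def, ← Lp.enorm_def, ← ofReal_norm, ← ofReal_norm, Lp.norm_fourier_eq]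
  have h := congrArg (fun y : ℝ≥0∞ => y ^ (2 : ℝ)) key
  simp only [eLpNorm_eq_lintegral_rpow_enorm_toReal two_ne_zero ENNReal.ofNat_ne_top,
    ENNReal.toReal_ofNat, ← ENNReal.rpow_mul] at h
  norm_num at h
  exact h

end Plancherel

/-! ### Transfer of tilings between functions with a common translation set. -/

section Tiling

variable {G : Type*} [AddCommGroup G] [MeasurableSpace G] [MeasurableAdd₂ G] [MeasurableNeg G]
  {μ : Measure G} [μ.IsAddLeftInvariant]

/-- Substituting `u = v - p i` in each term moves the sum over translates from `F` to `D`: both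
sides are the convolution of `F`, `D` and the sum of unit masses at the `p i`, evaluated at `y`. -/
theorem lintegral_mul_tsum_translates {ι : Type*} [Countable ι] {F D : G → ℝ≥0∞}
    (hF : Measurable F) (hD : Measurable D) (p : ι → G) (y : G) :
    ∫⁻ u, D u * ∑' i, F (y - u - p i) ∂μ = ∫⁻ v, F (y - v) * ∑' i, D (v - p i) ∂μ := by
  have h1 : ∀ i, Measurable fun u => D u * F (y - u - p i) := fun i => by fun_prop
  have h2 : ∀ i, Measurable fun v => F (y - v) * D (v - p i) := fun i => by fun_prop
  simp_rw [← ENNReal.tsum_mul_left]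
  rw [lintegral_tsum fun i => (h1 i).aemeasurable, lintegral_tsum fun i => (h2 i).aemeasurable]
  refine tsum_congr fun i => ?_
  rw [← lintegral_sub_right_eq_self (fun u => D u * F (y - u - p i)) (p i)]
  refine lintegral_congr fun v => ?_
  rw [mul_comm]
  congr 2
  abel

variable [μ.IsNegInvariant]

/-- If `F` tiles with the translates `p` and `D` packs, then `∫ D ≤ ∫ F`. -/
theorem lintegral_le_of_tiles_of_packs {ι : Type*} [Countable ι] {F D : G → ℝ≥0∞}
    (hF : Measurable F) (hD : Measurable D) (p : ι → G)
    (hFt : ∀ᵐ x ∂μ, ∑' i, F (x - p i) = 1) (hDp : ∀ᵐ x ∂μ, ∑' i, D (x - p i) ≤ 1) :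
    ∫⁻ x, D x ∂μ ≤ ∫⁻ x, F x ∂μ := by
  have h0 := lintegral_mul_tsum_translates (μ := μ) hF hD p 0
  have hFt' : ∀ᵐ u ∂μ, ∑' i, F (0 - u - p i) = 1 :=
    (Measure.measurePreserving_sub_left μ (0 : G)).quasiMeasurePreserving.ae hFt
  calc ∫⁻ x, D x ∂μ = ∫⁻ u, D u * ∑' i, F (0 - u - p i) ∂μ :=
        lintegral_congr_ae (by filter_upwards [hFt'] with u hu; rw [hu, mul_one])
    _ = ∫⁻ v, F (0 - v) * ∑' i, D (v - p i) ∂μ := h0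
    _ ≤ ∫⁻ v, F (0 - v) ∂μ := lintegral_mono_ae (by
        filter_upwards [hDp] with v hv; exact mul_le_of_le_one_right' hv)
    _ = ∫⁻ x, F x ∂μ := lintegral_sub_left_eq_self F 0

/-- If `F` tiles with the translates `p`, `D` packs and both have integral one, then `D` tiles. -/
theorem tiles_of_tiles_of_packs [SFinite μ] {ι : Type*} [Countable ι] {F D : G → ℝ≥0∞}
    (hF : Measurable F) (hD : Measurable D) (p : ι → G)
    (hF1 : ∫⁻ x, F x ∂μ = 1) (hD1 : ∫⁻ x, D x ∂μ = 1)
    (hFt : ∀ᵐ x ∂μ, ∑' i, F (x - p i) = 1) (hDp : ∀ᵐ x ∂μ, ∑' i, D (x - p i) ≤ 1) :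
    ∀ᵐ x ∂μ, ∑' i, D (x - p i) = 1 := by
  set T : G → ℝ≥0∞ := fun v => ∑' i, D (v - p i) with hT
  have hTm : Measurable T := Measurable.tsum fun i => by fun_prop
  -- Against the weight `F (y - ·)` the functions `T` and `1` have the same integral, so the
  -- deficiency `1 - T` vanishes where the weight lives. Integrating over all `y` below removes the
  -- weight.
  have hy : ∀ y, ∫⁻ v, F (y - v) * (1 - T v) ∂μ = 0 := by
    intro y
    have hFt' : ∀ᵐ u ∂μ, ∑' i, F (y - u - p i) = 1 :=
      (Measure.measurePreserving_sub_left μ y).quasiMeasurePreserving.ae hFt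
    have h0 : ∫⁻ v, F (y - v) * T v ∂μ = 1 := by
      rw [← lintegral_mul_tsum_translates hF hD p y, ← hD1]
      exact lintegral_congr_ae (by filter_upwards [hFt'] with u hu; rw [hu, mul_one])
    have h1 : ∫⁻ v, F (y - v) * T v + F (y - v) * (1 - T v) ∂μ = 1 := by
      refine (lintegral_congr_ae ?_).trans ((lintegral_sub_left_eq_self F y).trans hF1)
      filter_upwards [hDp] with v hv
      rw [← mul_add, add_tsub_cancel_of_le hv, mul_one]
    rw [lintegral_add_left (by fun_prop), h0] at h1
    simpa using h1
  have h2 : ∫⁻ v, (1 - T v) ∂μ = 0 := by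
    have hsw : ∫⁻ y, ∫⁻ v, F (y - v) * (1 - T v) ∂μ ∂μ =
        ∫⁻ v, ∫⁻ y, F (y - v) * (1 - T v) ∂μ ∂μ :=
      lintegral_lintegral_swap (by fun_prop)
    simp only [hy, lintegral_zero] at hsw
    rw [hsw]
    refine lintegral_congr fun v => ?_
    rw [lintegral_mul_const _ (by fun_prop), lintegral_sub_right_eq_self F v, hF1, one_mul]
  rw [lintegral_eq_zero_iff (by fun_prop)] at h2
  filter_upwards [h2, hDp] with v hv hv'
  exact le_antisymm hv' (tsub_eq_zero_iff_le.1 hv)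

end Tiling

end TwoIntervalGabor

noncomputable section

namespace TwoIntervalGabor

/-! ### Gabor systems with an indicator window: Moyal, Bessel and Parseval. -/

section Gabor

open FourierTransform

variable {S : Set ℝ}

theorem measurable_chi (hS : MeasurableSet S) : Measurable (chi S) :=
  measurable_const.indicator hS

theorem conj_chi (S : Set ℝ) (x : ℝ) : conj (chi S x) = chi S x := by
  by_cases hx : x ∈ S <;> simp [chi, hx]

theorem enorm_chi_sq (S : Set ℝ) (x : ℝ) : ‖chi S x‖ₑ ^ 2 = S.indicator 1 x := by
  by_cases hx : x ∈ S <;> simp [chi, hx]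

theorem norm_chi_le (S : Set ℝ) (x : ℝ) : ‖chi S x‖ ≤ 1 := by
  by_cases hx : x ∈ S <;> simp [chi, hx]

theorem memLp_chi (hS : MeasurableSet S) (hfin : volume S ≠ ∞) (q : ℝ≥0∞) :
    MemLp (chi S) q :=
  memLp_indicator_const q hS 1 (Or.inr hfin)

theorem memLp_chi_sub (hS : MeasurableSet S) (hfin : volume S ≠ ∞) (q : ℝ≥0∞) (t : ℝ) :
    MemLp (fun x => chi S (x - t)) q :=
  (memLp_chi hS hfin q).comp_measurePreserving (measurePreserving_sub_right volume t)

theorem memLp_tfShift (hS : MeasurableSet S) (hfin : volume S ≠ ∞) (p : ℝ × ℝ) :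
    MemLp (tfShift (chi S) p) 2 := by
  refine (memLp_chi_sub hS hfin 2 p.1).mono ?_ (Filter.Eventually.of_forall fun x => ?_)
  · have := measurable_chi hS
    unfold tfShift
    exact Measurable.aestronglyMeasurable (by fun_prop)
  · rw [tfShift, norm_mul, show (2 * Real.pi * Complex.I * (x * p.2 : ℝ) : ℂ) =
      ((2 * Real.pi * (x * p.2) : ℝ) : ℂ) * Complex.I by push_cast; ring,
      Complex.norm_exp_ofReal_mul_I, mul_one]

/-- The class of `tfShift (chi S) p` in `L²(ℝ)`. -/
def gaborVec (hS : MeasurableSet S) (hfin : volume S ≠ ∞) (p : ℝ × ℝ) :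
    Lp ℂ 2 (volume : Measure ℝ) :=
  (memLp_tfShift hS hfin p).toLp _

theorem inner_gaborVec (hS : MeasurableSet S) (hfin : volume S ≠ ∞) (p : ℝ × ℝ)
    (f : Lp ℂ 2 (volume : Measure ℝ)) :
    inner ℂ (gaborVec hS hfin p) f = stft (chi S) f p := by
  rw [L2.inner_def, stft]
  refine integral_congr_ae ?_
  filter_upwards [(memLp_tfShift hS hfin p).coeFn_toLp] with x hx
  rw [gaborVec, hx, tfShift, RCLike.inner_apply, map_mul, ← Complex.exp_conj]
  simp only [map_mul, Complex.conj_I, Complex.conj_ofReal, map_ofNat]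
  ring_nf

theorem stft_congr_ae {g f f' : ℝ → ℂ} (h : f =ᵐ[volume] f') (p : ℝ × ℝ) :
    stft g f p = stft g f' p :=
  integral_congr_ae (by filter_upwards [h] with x hx; rw [hx])

/-- Time-frequency shifts compose up to a phase, so after translating by `q.1` only `p - q` matters
for the modulus. -/
theorem inner_gaborVec_gaborVec (hS : MeasurableSet S) (hfin : volume S ≠ ∞) (p q : ℝ × ℝ) :
    inner ℂ (gaborVec hS hfin p) (gaborVec hS hfin q) =
      Complex.exp (((2 * Real.pi * (q.1 * (q.2 - p.2)) : ℝ) : ℂ) * Complex.I) *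
        stft (chi S) (chi S) (p - q) := by
  rw [inner_gaborVec, gaborVec, stft_congr_ae (memLp_tfShift hS hfin q).coeFn_toLp, stft, stft,
    ← integral_add_right_eq_self _ q.1, ← integral_const_mul]
  congr 1 with x
  have e : x + q.1 - p.1 = x - (p - q).1 := by simp; ring
  rw [tfShift, add_sub_cancel_right, e]
  have : ∀ a b c d e' : ℂ, Complex.exp b * Complex.exp c = Complex.exp d * Complex.exp e' →
      a * Complex.exp b * conj (chi S (x - (p - q).1)) * Complex.exp c =
      Complex.exp d * (a * conj (chi S (x - (p - q).1)) * Complex.exp e') := by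
    intro a b c d e' h
    linear_combination (a * conj (chi S (x - (p - q).1))) * h
  apply this
  rw [← Complex.exp_add, ← Complex.exp_add]
  congr 1
  simp
  ring

theorem norm_inner_gaborVec_gaborVec (hS : MeasurableSet S) (hfin : volume S ≠ ∞) (p q : ℝ × ℝ) :
    ‖inner ℂ (gaborVec hS hfin p) (gaborVec hS hfin q)‖ = ‖stft (chi S) (chi S) (p - q)‖ := by
  rw [inner_gaborVec_gaborVec, norm_mul, Complex.norm_exp_ofReal_mul_I, one_mul]

theorem stft_neg_eq_zero (hS : MeasurableSet S) (hfin : volume S ≠ ∞) {p : ℝ × ℝ}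
    (h : stft (chi S) (chi S) p = 0) : stft (chi S) (chi S) (-p) = 0 := by
  rw [← norm_eq_zero] at h ⊢
  rw [← sub_zero p, ← norm_inner_gaborVec_gaborVec hS hfin] at h
  rw [← zero_sub, ← norm_inner_gaborVec_gaborVec hS hfin, norm_inner_symm, h]

theorem stft_eq_fourier (g f : ℝ → ℂ) (t ν : ℝ) :
    stft g f (t, ν) = 𝓕 (fun x => f x * conj (g (x - t))) ν := by
  rw [Real.fourier_real_eq_integral_exp_smul, stft]
  congr 1 with x
  rw [smul_eq_mul, mul_comm]
  congr 2
  push_cast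
  ring

theorem measurable_stft (hS : MeasurableSet S) {f : ℝ → ℂ} (hf : Measurable f) :
    Measurable (stft (chi S) f) := by
  have := measurable_chi hS
  refine StronglyMeasurable.measurable (StronglyMeasurable.integral_prod_right
    (f := fun (p : ℝ × ℝ) (x : ℝ) => f x * conj (chi S (x - p.1)) *
      Complex.exp (-(2 * Real.pi * Complex.I * (x * p.2 : ℝ)))) ?_)
  refine Measurable.stronglyMeasurable ?_
  simp_rw [Function.uncurry_def, conj_chi]
  fun_prop

/-- Moyal's identity for a window that is the indicator function of a set of measure one. -/
theorem lintegral_enorm_stft_sq (hS : MeasurableSet S) (hS1 : volume S = 1) {f : ℝ → ℂ}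
    (hf : Measurable f) (hf2 : MemLp f 2) :
    ∫⁻ p, ‖stft (chi S) f p‖ₑ ^ 2 = ∫⁻ x, ‖f x‖ₑ ^ 2 := by
  have hχ := measurable_chi hS
  have hfin : volume S ≠ ∞ := by simp [hS1]
  have h1 : ∀ t, Integrable fun x => f x * conj (chi S (x - t)) := fun t => by
    simp_rw [conj_chi]
    exact hf2.integrable_mul (memLp_chi_sub hS hfin 2 t)
  have h2 : ∀ t, MemLp (fun x => f x * conj (chi S (x - t))) 2 := fun t => by
    simp_rw [conj_chi]
    refine hf2.mono (Measurable.aestronglyMeasurable (by fun_prop))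
      (Filter.Eventually.of_forall fun x => ?_)
    rw [norm_mul]
    exact mul_le_of_le_one_right (norm_nonneg _) (norm_chi_le _ _)
  rw [Measure.volume_eq_prod,
    lintegral_prod _ (((measurable_stft hS hf).enorm.pow_const 2).aemeasurable)]
  -- For fixed `t`, Plancherel in `ν` turns the inner integral into that of `|f(x)|² |g(x - t)|²`.
  -- Integrating over `t` first then contributes the factor `|S| = 1`.
  simp_rw [stft_eq_fourier, lintegral_enorm_fourier_sq (h1 _) (h2 _), conj_chi, enorm_mul, mul_pow]
  rw [lintegral_lintegral_swap (by fun_prop)]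
  refine lintegral_congr fun x => ?_
  rw [lintegral_const_mul _ (by fun_prop),
    lintegral_sub_left_eq_self (fun y => ‖chi S y‖ₑ ^ 2) x]
  simp_rw [enorm_chi_sq]
  rw [lintegral_indicator_one hS, hS1, mul_one]

theorem lintegral_enorm_stft_chi_sq (hS : MeasurableSet S) (hS1 : volume S = 1) :
    ∫⁻ p, ‖stft (chi S) (chi S) p‖ₑ ^ 2 = 1 := by
  rw [lintegral_enorm_stft_sq hS hS1 (measurable_chi hS) (memLp_chi hS (by simp [hS1]) 2)]
  simp_rw [enorm_chi_sq]
  rw [lintegral_indicator_one hS, hS1]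

theorem norm_gaborVec (hS : MeasurableSet S) (hS1 : volume S = 1) (p : ℝ × ℝ) :
    ‖gaborVec hS (by simp [hS1]) p‖ = 1 := by
  have h := norm_inner_gaborVec_gaborVec hS (by simp [hS1]) p p
  rw [sub_self, inner_self_eq_norm_sq_to_K] at h
  have h0 : stft (chi S) (chi S) 0 = 1 := by
    have : ∀ x, chi S x * conj (chi S (x - (0 : ℝ × ℝ).1)) *
        Complex.exp (-(2 * Real.pi * Complex.I * (x * (0 : ℝ × ℝ).2 : ℝ))) =
        S.indicator (fun _ => 1) x := fun x => by
      by_cases hx : x ∈ S <;> simp [chi, hx]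
    simp_rw [stft, this]
    rw [integral_indicator_const _ hS, Measure.real, hS1]
    simp
  rw [h0] at h
  simp only [norm_pow, norm_one] at h
  have h' : ‖gaborVec hS (by simp [hS1]) p‖ ^ 2 = 1 := by simpa using h
  exact (pow_eq_one_iff_of_nonneg (norm_nonneg _) two_ne_zero).1 h'

theorem orthonormal_gaborVec_iff (hS : MeasurableSet S) (hS1 : volume S = 1)
    (Λ : Set (ℝ × ℝ)) :
    Orthonormal ℂ (fun p : Λ => gaborVec hS (by simp [hS1]) p) ↔
      Λ - Λ ⊆ zeroSet (chi S) ∪ {0} := by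
  constructor
  · rintro ⟨-, h⟩ _ ⟨p, hp, q, hq, rfl⟩
    by_cases hpq : p = q
    · right; simp [hpq]
    · left
      have := h (i := ⟨p, hp⟩) (j := ⟨q, hq⟩) (by simpa using hpq)
      simp only at this
      rw [zeroSet, Set.mem_ofPred_eq, ← norm_eq_zero,
        ← norm_inner_gaborVec_gaborVec hS (by simp [hS1]), this, norm_zero]
  · intro h
    refine ⟨fun p => norm_gaborVec hS hS1 p, fun p q hpq => ?_⟩
    simp only
    rcases h ⟨p, p.2, q, q.2, rfl⟩ with h' | h'
    · rw [← norm_eq_zero, norm_inner_gaborVec_gaborVec]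
      simpa [zeroSet] using h'
    · exact absurd (Subtype.ext (sub_eq_zero.1 h')) hpq

/-- Distinct members lie at distance `√2`, so the balls of radius `1/2` around them are disjoint
open sets. -/
theorem countable_of_orthonormal {E ι : Type*} [NormedAddCommGroup E] [InnerProductSpace ℂ E]
    [TopologicalSpace.SeparableSpace E] {v : ι → E} (hv : Orthonormal ℂ v) : Countable ι := by
  have hd : Pairwise (Function.onFun Disjoint fun i => Metric.ball (v i) (1 / 2)) := by
    intro i j hij
    refine Metric.ball_disjoint_ball ?_
    have h2 : ‖v i - v j‖ ^ 2 = 2 := by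
      rw [@norm_sub_sq ℂ, hv.2 hij, hv.1, hv.1]
      norm_num
    rw [dist_eq_norm]
    nlinarith [norm_nonneg (v i - v j)]
  exact hd.countable_of_isOpen_disjoint (fun i => Metric.isOpen_ball)
    fun i => ⟨v i, Metric.mem_ball_self (by norm_num)⟩

/-- If Parseval's identity holds at `x` for an orthonormal family, then `x` is orthogonal to every
vector that is orthogonal to the family. -/
theorem inner_eq_zero_of_parseval {E ι : Type*} [NormedAddCommGroup E] [InnerProductSpace ℂ E]
    {v : ι → E} (hv : Orthonormal ℂ v) {x f : E} (hx : ∑' i, ‖inner ℂ (v i) x‖ ^ 2 = ‖x‖ ^ 2)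
    (hf : ∀ i, inner ℂ (v i) f = 0) : inner ℂ x f = 0 := by
  -- Adding a multiple of `f` leaves the coefficients unchanged, so Bessel at `x + c • f` bounds its
  -- norm below by that of `x`. If `⟨x, f⟩ ≠ 0`, a small step in the direction `-conj ⟨x, f⟩` would
  -- decrease the norm.
  have hle : ∀ c : ℂ, ‖x‖ ^ 2 ≤ ‖x + c • f‖ ^ 2 := fun c => by
    have := hv.tsum_inner_products_le (x + c • f)
    simpa [inner_add_right, inner_smul_right, hf, hx] using this
  by_contra hw
  set w := inner ℂ x f with hwdef
  have hwpos : 0 < ‖w‖ ^ 2 := by positivity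
  set ε : ℝ := 1 / (‖f‖ ^ 2 + 1) with hε
  have hε0 : 0 < ε := by positivity
  have h := hle (-(ε : ℂ) * conj w)
  rw [@norm_add_sq ℂ, inner_smul_right, ← hwdef, norm_smul, mul_pow, mul_assoc,
    Complex.conj_mul', norm_mul, norm_neg, Complex.norm_real, Complex.norm_conj,
    Real.norm_of_nonneg hε0.le] at h
  have hre : RCLike.re (-(ε : ℂ) * (‖w‖ : ℂ) ^ 2) = -(ε * ‖w‖ ^ 2) := by
    rw [RCLike.re_eq_complex_re, ← Complex.ofReal_pow, ← Complex.ofReal_neg,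
      ← Complex.ofReal_mul, Complex.ofReal_re]
    ring
  rw [hre] at h
  have hε1 : ε * (‖f‖ ^ 2 + 1) = 1 := by rw [hε]; field_simp
  have h2 : 0 ≤ ε * ‖w‖ ^ 2 * (ε * ‖f‖ ^ 2 - 2) := by nlinarith
  have h3 : ε * ‖f‖ ^ 2 - 2 < 0 := by nlinarith
  have h4 : 0 < ε * ‖w‖ ^ 2 := by positivity
  nlinarith

theorem countable_of_orthonormal_L2 {ι : Type*} {v : ι → Lp ℂ 2 (volume : Measure ℝ)}
    (hv : Orthonormal ℂ v) : Countable ι := by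
  have : Fact ((2 : ℝ≥0∞) ≠ ∞) := ⟨ENNReal.ofNat_ne_top⟩
  exact countable_of_orthonormal hv

/-- The Gabor system of `chi S` is an orthonormal basis if its members are orthonormal and some
set of area one tiles the plane with the same translations. -/
theorem isGaborONB_of_tiles (hS : MeasurableSet S) (hS1 : volume S = 1) {Λ D : Set (ℝ × ℝ)}
    (hΛ : Λ - Λ ⊆ zeroSet (chi S) ∪ {0}) (hD : MeasurableSet D) (hD1 : volume D = 1)
    (hT : Tiles D Λ) : IsGaborONB (chi S) Λ := by
  have hfin : volume S ≠ ∞ := by simp [hS1]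
  have ho := (orthonormal_gaborVec_iff hS hS1 Λ).2 hΛ
  have : Countable Λ := countable_of_orthonormal_L2 ho
  have hbessel : ∀ z : ℝ × ℝ, ∑' p : Λ, ‖stft (chi S) (chi S) (z - p)‖ₑ ^ 2 =
      ENNReal.ofReal (∑' p : Λ, ‖inner ℂ (gaborVec hS hfin p) (gaborVec hS hfin z)‖ ^ 2) := by
    intro z
    rw [ENNReal.ofReal_tsum_of_nonneg (fun _ => by positivity)
      (ho.inner_products_summable (gaborVec hS hfin z))]
    refine tsum_congr fun p => ?_
    rw [norm_inner_symm, norm_inner_gaborVec_gaborVec, ENNReal.ofReal_pow (norm_nonneg _),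
      ofReal_norm]
  -- Here the set `D` is the function that tiles, and `|V|²` the one that packs, by Bessel.
  have htile := tiles_of_tiles_of_packs (μ := (volume : Measure (ℝ × ℝ)))
    (F := D.indicator fun _ => 1) (D := fun z => ‖stft (chi S) (chi S) z‖ₑ ^ 2)
    (measurable_const.indicator hD) ((measurable_stft hS (measurable_chi hS)).enorm.pow_const 2)
    (fun p : Λ => (p : ℝ × ℝ)) (by rw [lintegral_indicator_const hD, hD1, one_mul])
    (lintegral_enorm_stft_chi_sq hS hS1) hT (Filter.Eventually.of_forall fun z => by
      rw [hbessel, ← ENNReal.ofReal_one]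
      refine ENNReal.ofReal_le_ofReal ?_
      have := ho.tsum_inner_products_le (gaborVec hS hfin z)
      rwa [norm_gaborVec hS hS1, one_pow] at this)
  have hbot : (Submodule.span ℂ (Set.range fun p : Λ => gaborVec hS hfin p))ᗮ = ⊥ := by
    rw [Submodule.eq_bot_iff]
    intro f hf
    have hf0 : ∀ p : Λ, inner ℂ (gaborVec hS hfin p) f = 0 := fun p =>
      Submodule.inner_right_of_mem_orthogonal (Submodule.subset_span (Set.mem_range_self p)) hf
    have hz : ∀ᵐ z : ℝ × ℝ, stft (chi S) f z = 0 := by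
      filter_upwards [htile] with z hz
      rw [hbessel, ENNReal.ofReal_eq_one] at hz
      rw [← inner_gaborVec hS hfin]
      exact inner_eq_zero_of_parseval ho (by rw [hz, norm_gaborVec hS hS1, one_pow]) hf0
    have hM := lintegral_enorm_stft_sq hS hS1 (Lp.stronglyMeasurable f).measurable (Lp.memLp f)
    rw [lintegral_congr_ae (g := fun _ => 0) (by filter_upwards [hz] with z hz; simp [hz]),
      lintegral_zero] at hM
    rw [eq_comm, lintegral_eq_zero_iff
      ((Lp.stronglyMeasurable f).measurable.enorm.pow_const 2)] at hM
    rw [Lp.eq_zero_iff_ae_eq_zero]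
    filter_upwards [hM] with x hx
    simpa using hx
  refine ⟨HilbertBasis.mkOfOrthogonalEqBot ho hbot, fun p => ?_⟩
  rw [HilbertBasis.coe_mkOfOrthogonalEqBot]
  exact (memLp_tfShift hS hfin p).coeFn_toLp

/-! ### Orthogonal packing regions. -/

/-- `D` is an orthogonal packing region for `g`: it meets its translate by a nonzero zero of
`V_g g` in a null set only. -/
def IsOrthPacking (g : ℝ → ℂ) (D : Set (ℝ × ℝ)) : Prop :=
  ∀ p ≠ 0, stft g g p = 0 → volume {x | x ∈ D ∧ x - p ∈ D} = 0

theorem IsOrthPacking.tsum_le_one {g : ℝ → ℂ} {D Λ : Set (ℝ × ℝ)} (hD : IsOrthPacking g D)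
    [Countable Λ] (hΛ : Λ - Λ ⊆ zeroSet g ∪ {0}) :
    ∀ᵐ x : ℝ × ℝ, ∑' p : Λ, D.indicator (fun _ => (1 : ℝ≥0∞)) (x - p) ≤ 1 := by
  have h : ∀ᵐ x : ℝ × ℝ, ∀ p q : Λ, p ≠ q → ¬ (x - p ∈ D ∧ x - q ∈ D) := by
    rw [ae_all_iff]; intro p
    rw [ae_all_iff]; intro q
    by_cases hpq : p = q
    · exact Filter.Eventually.of_forall fun x h => absurd hpq h
    have hne : (q : ℝ × ℝ) - p ≠ 0 := fun h => hpq (Subtype.ext (sub_eq_zero.1 h).symm)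
    have h0 : stft g g ((q : ℝ × ℝ) - p) = 0 := by
      rcases hΛ ⟨q, q.2, p, p.2, rfl⟩ with h | h
      · exact h
      · exact absurd h hne
    have hnull : ∀ᵐ y : ℝ × ℝ, ¬ (y ∈ D ∧ y - ((q : ℝ × ℝ) - p) ∈ D) := by
      rw [ae_iff]; simpa using hD _ hne h0
    have := (measurePreserving_sub_right (volume : Measure (ℝ × ℝ))
      (p : ℝ × ℝ)).quasiMeasurePreserving.ae hnull
    filter_upwards [this] with x hx _
    simpa using hx
  filter_upwards [h] with x hx
  by_cases he : ∃ p : Λ, x - p ∈ D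
  · obtain ⟨p, hp⟩ := he
    rw [tsum_eq_single p fun q hq => Set.indicator_of_notMem (fun hqD => hx q p hq ⟨hqD, hp⟩) _]
    simp [hp]
  · push Not at he
    rw [ENNReal.tsum_eq_zero.2 fun p => Set.indicator_of_notMem (he p) _]
    exact zero_le_one

/-- The last assertion is Parseval's identity at the shift `g_z` of the window itself. -/
theorem IsGaborONB.orthonormal_and_tiles (hS : MeasurableSet S) (hS1 : volume S = 1)
    {Λ : Set (ℝ × ℝ)} (h : IsGaborONB (chi S) Λ) :
    Λ - Λ ⊆ zeroSet (chi S) ∪ {0} ∧ Countable Λ ∧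
      ∀ᵐ z : ℝ × ℝ, ∑' p : Λ, ‖stft (chi S) (chi S) (z - p)‖ₑ ^ 2 = 1 := by
  have hfin : volume S ≠ ∞ := by simp [hS1]
  obtain ⟨b, hb⟩ := h
  have hbe : ∀ p : Λ, b p = gaborVec hS hfin p := fun p =>
    Lp.ext ((hb p).trans (memLp_tfShift hS hfin p).coeFn_toLp.symm)
  have ho : Orthonormal ℂ (fun p : Λ => gaborVec hS hfin p) := by
    have := b.orthonormal
    rwa [show (b : Λ → _) = fun p : Λ => gaborVec hS hfin p from funext hbe] at this
  refine ⟨(orthonormal_gaborVec_iff hS hS1 Λ).1 ho, countable_of_orthonormal_L2 ho,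
    Filter.Eventually.of_forall fun z => ?_⟩
  have hsum := b.hasSum_inner_mul_inner (gaborVec hS hfin z) (gaborVec hS hfin z)
  have hre := Complex.hasSum_re hsum
  have e1 : ∀ p : Λ, (inner ℂ (gaborVec hS hfin z) (b p) *
      inner ℂ (b p) (gaborVec hS hfin z)).re = ‖stft (chi S) (chi S) (z - p)‖ ^ 2 := fun p => by
    rw [← RCLike.re_eq_complex_re, inner_mul_symm_re_eq_norm, norm_mul, norm_inner_symm (b p), ← sq, hbe,
      norm_inner_gaborVec_gaborVec]
  simp_rw [e1] at hre
  have e2 : (inner ℂ (gaborVec hS hfin z) (gaborVec hS hfin z)).re = 1 := by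
    have := inner_self_eq_norm_sq (𝕜 := ℂ) (gaborVec hS hfin z)
    rw [norm_gaborVec hS hS1, one_pow] at this
    exact this
  rw [e2] at hre
  have := ENNReal.ofReal_tsum_of_nonneg (fun _ => by positivity) hre.summable
  rw [hre.tsum_eq, ENNReal.ofReal_one] at this
  rw [this]
  refine tsum_congr fun p => ?_
  rw [ENNReal.ofReal_pow (norm_nonneg _), ofReal_norm]

theorem IsGaborONB.tiles (hS : MeasurableSet S) (hS1 : volume S = 1) {Λ D : Set (ℝ × ℝ)}
    (h : IsGaborONB (chi S) Λ) (hD : MeasurableSet D) (hD1 : volume D = 1)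
    (hp : IsOrthPacking (chi S) D) : Tiles D Λ := by
  obtain ⟨hΛ, _, ht⟩ := h.orthonormal_and_tiles hS hS1
  exact tiles_of_tiles_of_packs ((measurable_stft hS (measurable_chi hS)).enorm.pow_const 2)
    (measurable_const.indicator hD) (fun p : Λ => (p : ℝ × ℝ))
    (lintegral_enorm_stft_chi_sq hS hS1) (by rw [lintegral_indicator_const hD, hD1, one_mul])
    ht (hp.tsum_le_one hΛ)

theorem IsGaborONB.volume_le_one (hS : MeasurableSet S) (hS1 : volume S = 1)
    {Λ D : Set (ℝ × ℝ)} (h : IsGaborONB (chi S) Λ) (hD : MeasurableSet D)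
    (hp : IsOrthPacking (chi S) D) : volume D ≤ 1 := by
  obtain ⟨hΛ, _, ht⟩ := h.orthonormal_and_tiles hS hS1
  have := lintegral_le_of_tiles_of_packs
    ((measurable_stft hS (measurable_chi hS)).enorm.pow_const 2)
    (measurable_const.indicator hD) (fun p : Λ => (p : ℝ × ℝ)) ht (hp.tsum_le_one hΛ)
  rwa [lintegral_indicator_const hD, one_mul, lintegral_enorm_stft_chi_sq hS hS1] at this

/-- A tight orthogonal packing region characterizes Gabor orthonormal bases by tiling. -/
theorem isGaborONB_iff_of_isOrthPacking (hS : MeasurableSet S) (hS1 : volume S = 1)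
    {Λ D : Set (ℝ × ℝ)} (hD : MeasurableSet D) (hD1 : volume D = 1)
    (hp : IsOrthPacking (chi S) D) :
    IsGaborONB (chi S) Λ ↔ Λ - Λ ⊆ zeroSet (chi S) ∪ {0} ∧ Tiles D Λ :=
  ⟨fun h => ⟨(h.orthonormal_and_tiles hS hS1).1, h.tiles hS hS1 hD hD1 hp⟩,
    fun h => isGaborONB_of_tiles hS hS1 h.1 hD hD1 h.2⟩

/-- If some orthogonal packing region has area greater than one, there is neither a Gabor
orthonormal basis nor an orthonormal system tiling with a set of area one. -/
theorem isGaborONB_iff_of_one_lt_volume (hS : MeasurableSet S) (hS1 : volume S = 1)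
    {Λ D D' : Set (ℝ × ℝ)} (hD : MeasurableSet D) (hD1 : volume D = 1)
    (hD' : MeasurableSet D') (hD'1 : 1 < volume D') (hp : IsOrthPacking (chi S) D') :
    IsGaborONB (chi S) Λ ↔ Λ - Λ ⊆ zeroSet (chi S) ∪ {0} ∧ Tiles D Λ :=
  ⟨fun h => absurd (h.volume_le_one hS hS1 hD' hp) (not_le.2 hD'1),
    fun h => isGaborONB_of_tiles hS hS1 h.1 hD hD1 h.2⟩

end Gabor

end TwoIntervalGabor

end

noncomputable section

namespace TwoIntervalGabor

/-! ### Zeros of Fourier transforms of unions of two or three intervals. -/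

section Zeros

open Real (pi sin cos pi_pos)

/-- The integral of `e^{-2π i x ν}` over `[a, b)`. -/
def expInt (ν a b : ℝ) : ℂ :=
  ∫ x in Set.Ico a b, Complex.exp (-(2 * pi * Complex.I * (x * ν : ℝ)))

theorem expInt_of_le {ν a b : ℝ} (h : b ≤ a) : expInt ν a b = 0 := by
  rw [expInt, Set.Ico_eq_empty (not_lt.2 h), Measure.restrict_empty, integral_zero_measure]

theorem expInt_zero (a b : ℝ) : expInt 0 a b = ((max (b - a) 0 : ℝ) : ℂ) := by
  simp [expInt, Measure.real, ENNReal.toReal_ofReal']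

theorem expInt_eq_sub {ν a b : ℝ} (hν : ν ≠ 0) (hab : a ≤ b) :
    expInt ν a b = (Complex.exp ((-(2 * pi * ν * a) : ℝ) * Complex.I) -
      Complex.exp ((-(2 * pi * ν * b) : ℝ) * Complex.I)) / (2 * pi * ν * Complex.I) := by
  have hc : -(2 * pi * ν * Complex.I : ℂ) ≠ 0 := by
    simp [hν, Real.pi_ne_zero]
  rw [expInt, integral_Ico_eq_integral_Ioc, ← intervalIntegral.integral_of_le hab]
  have : ∀ x : ℝ, Complex.exp (-(2 * pi * Complex.I * (x * ν : ℝ))) =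
      Complex.exp (-(2 * pi * ν * Complex.I) * x) := fun x => by
    congr 1; push_cast; ring
  simp_rw [this]
  rw [integral_exp_mul_complex hc, div_neg, ← neg_div, neg_sub]
  congr 3 <;> · push_cast; ring

/-- Centring at the midpoint splits the integral into a real amplitude, which depends on the length,
and a phase, which depends on the midpoint. -/
theorem expInt_eq_sin {ν a b : ℝ} (hν : ν ≠ 0) (hab : a ≤ b) :
    expInt ν a b = ((sin (pi * ν * (b - a)) / (pi * ν) : ℝ) : ℂ) *
      Complex.exp ((-(pi * ν * (a + b)) : ℝ) * Complex.I) := by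
  have h1 : Complex.exp ((-(2 * pi * ν * a) : ℝ) * Complex.I) =
      Complex.exp ((-(pi * ν * (a + b)) : ℝ) * Complex.I) *
        Complex.exp ((pi * ν * (b - a) : ℝ) * Complex.I) := by
    rw [← Complex.exp_add]; congr 1; push_cast; ring
  have h2 : Complex.exp ((-(2 * pi * ν * b) : ℝ) * Complex.I) =
      Complex.exp ((-(pi * ν * (a + b)) : ℝ) * Complex.I) *
        Complex.exp (-(pi * ν * (b - a) : ℝ) * Complex.I) := by
    rw [← Complex.exp_add]; congr 1; push_cast; ring
  have hν' : (ν : ℂ) ≠ 0 := by exact_mod_cast hν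
  have hpi : (pi : ℂ) ≠ 0 := by exact_mod_cast Real.pi_ne_zero
  rw [expInt_eq_sub hν hab, h1, h2, Complex.ofReal_div, Complex.ofReal_sin, Complex.sin]
  rw [Complex.ofReal_mul pi ν]
  field_simp
  rw [Complex.I_sq]
  ring

theorem expInt_ne_zero {ν a b : ℝ} (hν : 0 < ν) (hab : a < b) (h : ν * (b - a) < 1) :
    expInt ν a b ≠ 0 := by
  rw [expInt_eq_sin hν.ne' hab.le]
  refine mul_ne_zero ?_ (Complex.exp_ne_zero _)
  have : 0 < sin (pi * ν * (b - a)) := by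
    refine Real.sin_pos_of_pos_of_lt_pi (by have := sub_pos.2 hab; positivity) ?_
    nlinarith [pi_pos]
  have := pi_pos
  exact_mod_cast (by positivity : sin (pi * ν * (b - a)) / (pi * ν) ≠ 0)

/-- A zero of the Fourier transform of the indicator function of two intervals at a low frequency
comes from intervals on which the contributions are equal in modulus and opposite in phase. -/
theorem odd_of_expInt_add_eq_zero {ν a b c d : ℝ} (hν : 0 < ν) (hab : a < b) (hcd : c < d)
    (hsum : ν * ((b - a) + (d - c)) < 2) (hdiff : ν * |(b - a) - (d - c)| < 1)
    (h : expInt ν a b + expInt ν c d = 0) :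
    (b - a = d - c ∨ ν * ((b - a) + (d - c)) = 1) ∧ ∃ k : ℤ, ν * (c + d - a - b) = 2 * k + 1 := by
  have hpi := pi_pos
  rw [expInt_eq_sin hν.ne' hab.le, expInt_eq_sin hν.ne' hcd.le] at h
  set l := b - a with hl
  set m := d - c with hm
  have hl0 : 0 < l := sub_pos.2 hab
  have hm0 : 0 < m := sub_pos.2 hcd
  set A := pi * ν * l with hA
  set B := pi * ν * m with hB
  have hA0 : 0 < A := by positivity
  have hB0 : 0 < B := by positivity
  have habs : |sin A| = |sin B| := by
    have h' := congrArg norm (eq_neg_of_add_eq_zero_left h)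
    rw [norm_neg, norm_mul, norm_mul, Complex.norm_exp_ofReal_mul_I,
      Complex.norm_exp_ofReal_mul_I, mul_one, mul_one, Complex.norm_real, Complex.norm_real,
      Real.norm_eq_abs, Real.norm_eq_abs, abs_div, abs_div] at h'
    have : |pi * ν| ≠ 0 := by positivity
    field_simp at h'
    exact h'
  -- This is `sin² A - sin² B`. The bounds `A + B < 2π` and `|A - B| < π` from `hsum` and `hdiff`
  -- leave only `A + B = π` or `A = B`.
  have hprod : sin (A + B) * sin (A - B) = 0 := by
    have hs := (sq_eq_sq_iff_abs_eq_abs _ _).2 habs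
    rw [Real.sin_add, Real.sin_sub]
    have h1 := Real.sin_sq_add_cos_sq A
    have h2 := Real.sin_sq_add_cos_sq B
    linear_combination hs + sin A ^ 2 * h2 - sin B ^ 2 * h1
  have hcase : l = m ∨ ν * (l + m) = 1 := by
    rcases mul_eq_zero.1 hprod with h0 | h0
    · right
      have h1 : sin (A + B - pi) = 0 := by rw [Real.sin_sub_pi, h0, neg_zero]
      have h2 := (Real.sin_eq_zero_iff_of_lt_of_lt (by linarith)
        (by have : A + B = pi * (ν * (l + m)) := by rw [hA, hB]; ring
            nlinarith)).1 h1
      have h3 : pi * (ν * (l + m) - 1) = 0 := by rw [← h2, hA, hB]; ring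
      rcases mul_eq_zero.1 h3 with h4 | h4 <;> linarith
    · left
      have hab' := abs_lt.1 (show |ν * (l - m)| < 1 by rwa [abs_mul, abs_of_pos hν])
      have e : A - B = pi * (ν * (l - m)) := by rw [hA, hB]; ring
      have h2 := (Real.sin_eq_zero_iff_of_lt_of_lt (by nlinarith) (by nlinarith)).1 h0
      rw [e] at h2
      have : l - m = 0 := by
        rcases mul_eq_zero.1 h2 with h4 | h4
        · linarith
        · exact (mul_eq_zero.1 h4).resolve_left hν.ne'
      linarith
  refine ⟨hcase, ?_⟩
  -- This makes the common amplitude nonzero; otherwise the phases would be unconstrained.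
  have hApi : A < pi := by
    rcases hcase with h0 | h0
    · have : A = pi * (ν * l) := by rw [hA]; ring
      rw [← h0] at hsum
      nlinarith
    · have : A = pi * (ν * l) := by rw [hA]; ring
      have : ν * l < 1 := by nlinarith [mul_pos hν hm0]
      nlinarith
  have hsin : sin A = sin B := by
    rcases hcase with h0 | h0
    · rw [hA, hB, h0]
    · rw [← Real.sin_pi_sub, show pi - A = B by rw [hA, hB]; linear_combination (-pi) * h0]
  have hsinpos : 0 < sin A := Real.sin_pos_of_pos_of_lt_pi hA0 hApi
  rw [← hsin, ← mul_add] at h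
  have hne : ((sin A / (pi * ν) : ℝ) : ℂ) ≠ 0 := by
    exact_mod_cast (by positivity : sin A / (pi * ν) ≠ 0)
  have hexp := (mul_eq_zero.1 h).resolve_left hne
  have hexp' : Complex.exp ((-(pi * ν * (a + b)) : ℝ) * Complex.I) =
      Complex.exp ((-(pi * ν * (c + d)) : ℝ) * Complex.I + pi * Complex.I) := by
    rw [Complex.exp_add, Complex.exp_pi_mul_I]
    linear_combination hexp
  obtain ⟨n, hn⟩ := Complex.exp_eq_exp_iff_exists_int.1 hexp'
  refine ⟨n, ?_⟩
  have hr : -(pi * ν * (a + b)) = -(pi * ν * (c + d)) + pi + n * (2 * pi) := by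
    have : ((-(pi * ν * (a + b)) : ℝ) : ℂ) =
        ((-(pi * ν * (c + d)) + pi + n * (2 * pi) : ℝ) : ℂ) := by
      apply mul_right_cancel₀ Complex.I_ne_zero
      rw [hn]; push_cast; ring
    exact_mod_cast this
  have : pi * (ν * (c + d - a - b) - (2 * n + 1)) = 0 := by linear_combination hr
  rcases mul_eq_zero.1 this with h4 | h4 <;> linarith

/-- In terms of the endpoint exponentials, `t` enters a vanishing sum only through one unimodular
factor. Taking moduli eliminates it and leaves `sin(πνβ) cos(πν(1+β)) sin(πν(1-2α)) = 0`, hence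
`ν(1+β) = 1/2`. At that frequency a suitable rotation puts all three terms in the open right
half-plane, so they cannot cancel. -/
theorem expInt_three_ne_zero {α β t ν : ℝ} (hβ : 0 < β) (hβt : β < t) (htα : t < α)
    (hα : α < 1 / 2) (hν : 0 < ν) (hν1 : ν < 1) :
    expInt ν t α + expInt ν (β + α + t) (β + 1) + expInt ν (β + α) (α + t) ≠ 0 := by
  intro h
  have hpi := pi_pos
  have hhalf : ν * (1 + β) = 1 / 2 := by
    have h' := h
    rw [expInt_eq_sub hν.ne' htα.le, expInt_eq_sub hν.ne' (by linarith),
      expInt_eq_sub hν.ne' (by linarith), ← add_div, ← add_div, div_eq_zero_iff] at h'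
    have hI : (2 * pi * ν * Complex.I : ℂ) ≠ 0 := by simp [hν.ne', Real.pi_ne_zero]
    replace h' := h'.resolve_right hI
    set u : ℝ → ℂ := fun x => Complex.exp ((-(2 * pi * ν * x) : ℝ) * Complex.I) with hu
    have hmul : ∀ x y, u (x + y) = u x * u y := fun x y => by
      simp only [hu]; rw [← Complex.exp_add]; congr 1; push_cast; ring
    have hun : ∀ x, ‖u x‖ = 1 := fun x => Complex.norm_exp_ofReal_mul_I _
    have hre : ∀ x, (u x).re = cos (2 * pi * ν * x) := fun x => by
      simp only [hu]; rw [Complex.exp_ofReal_mul_I_re, Real.cos_neg]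
    have him : ∀ x, (u x).im = -sin (2 * pi * ν * x) := fun x => by
      simp only [hu]; rw [Complex.exp_ofReal_mul_I_im, Real.sin_neg]
    have e1 : u t * (u 0 - u α + u (β + α)) = u α + u (β + 1) - u (β + α) := by
      have h0 : u t - u α + (u (β + α + t) - u (β + 1)) + (u (β + α) - u (α + t)) = 0 := h'
      have z : u 0 = 1 := by simp [hu]
      rw [hmul (β + α) t, hmul α t] at h0
      rw [z]
      linear_combination h0
    have e2 := congrArg Complex.normSq e1
    rw [map_mul, Complex.normSq_eq_norm_sq (u t), hun, one_pow, one_mul] at e2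
    simp only [Complex.normSq_apply, Complex.add_re, Complex.add_im, Complex.sub_re,
      Complex.sub_im, hre, him, mul_zero, Real.cos_zero, Real.sin_zero] at e2
    set a := 2 * pi * ν * α with ha
    set B := pi * ν * β with hB
    set C := pi * ν with hC
    have k1 : 2 * pi * ν * (β + α) = 2 * B + a := by rw [ha, hB]; ring
    have k2 : 2 * pi * ν * (β + 1) = 2 * B + 2 * C := by rw [hB]; ring
    rw [k1, k2] at e2
    have hfac : sin B * cos (C + B) * sin (C - a) = 0 := by
      have c1 : cos (2 * B + a) - cos a = -2 * sin (B + a) * sin B := by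
        rw [Real.cos_sub_cos]; ring_nf
      have c2 : cos (2 * C - a) - cos (2 * B + (2 * C - a)) =
          2 * sin (2 * C - a + B) * sin B := by
        rw [Real.cos_sub_cos, show (2 * C - a - (2 * B + (2 * C - a))) / 2 = -B by ring,
          Real.sin_neg]
        ring_nf
      have c3 : sin (2 * C - a + B) - sin (B + a) = 2 * sin (C - a) * cos (C + B) := by
        rw [Real.sin_sub_sin]; ring_nf
      have d2 : cos (2 * C - a) = cos (2 * B + 2 * C) * cos (2 * B + a) +
          sin (2 * B + 2 * C) * sin (2 * B + a) := by
        rw [← Real.cos_sub]; ring_nf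
      have d3 : cos (2 * B + (2 * C - a)) = cos (2 * B + 2 * C) * cos a +
          sin (2 * B + 2 * C) * sin a := by
        rw [← Real.cos_sub]; ring_nf
      have s3 := Real.sin_sq_add_cos_sq (2 * B + 2 * C)
      have key : 8 * (sin B * cos (C + B) * sin (C - a)) =
          2 * ((cos (2 * B + a) - cos a) + (cos (2 * C - a) - cos (2 * B + (2 * C - a)))) := by
        rw [c1, c2]; linear_combination (-4 * sin B) * c3
      rw [d2, d3] at key
      linear_combination key / 8 + e2 / 8 + s3 / 8
    have hsB : sin B ≠ 0 := by
      refine (Real.sin_pos_of_pos_of_lt_pi (by positivity) ?_).ne'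
      have : ν * β < 1 := by nlinarith
      have : B = pi * (ν * β) := by rw [hB]; ring
      nlinarith
    have hsC : sin (C - a) ≠ 0 := by
      have e : C - a = pi * (ν * (1 - 2 * α)) := by rw [ha, hC]; ring
      have h1 : 0 < ν * (1 - 2 * α) := mul_pos hν (by linarith)
      have h2 : ν * (1 - 2 * α) < 1 := by nlinarith
      rw [e]
      exact (Real.sin_pos_of_pos_of_lt_pi (by positivity) (by nlinarith)).ne'
    have hcos : cos (C + B) = 0 := by
      rcases mul_eq_zero.1 hfac with h1 | h1
      · exact (mul_eq_zero.1 h1).resolve_left hsB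
      · exact absurd h1 hsC
    obtain ⟨k, hk⟩ := Real.cos_eq_zero_iff.1 hcos
    have hk' : 2 * (ν * (1 + β)) = 2 * k + 1 := by
      have : pi * (2 * (ν * (1 + β)) - (2 * k + 1)) = 0 := by
        rw [hC, hB] at hk; linear_combination 2 * hk
      rcases mul_eq_zero.1 this with h4 | h4 <;> linarith
    have hpos : 0 < ν * (1 + β) := by positivity
    have hlt : ν * (1 + β) < 3 / 2 := by nlinarith
    have hk0 : k = 0 := by
      have h1 : (-1 : ℝ) < k := by linarith
      have h2 : (k : ℝ) < 1 := by linarith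
      have h1' : -1 < k := by exact_mod_cast h1
      have h2' : k < 1 := by exact_mod_cast h2
      omega
    rw [hk0] at hk'
    push_cast at hk'
    linarith
  rw [expInt_eq_sin hν.ne' htα.le, expInt_eq_sin hν.ne' (by linarith),
    expInt_eq_sin hν.ne' (by linarith)] at h
  have h2 := congrArg (fun z => (z * Complex.exp ((pi * ν * (t + β + 1) : ℝ) * Complex.I)).re) h
  have hmulre : ∀ r x y : ℝ, ((r : ℂ) * Complex.exp (x * Complex.I) *
      Complex.exp (y * Complex.I)).re = r * cos (x + y) := fun r x y => by
    rw [mul_assoc, ← Complex.exp_add, ← add_mul, ← Complex.ofReal_add, Complex.re_ofReal_mul,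
      Complex.exp_ofReal_mul_I_re]
  simp only [add_mul, zero_mul, Complex.zero_re, Complex.add_re, hmulre] at h2
  have hcospos : ∀ x, |x| < 1 + β → 0 < cos (pi * ν * x) := by
    intro x hx
    rw [abs_lt] at hx
    have e : pi * ν * x = pi * (ν * x) := by ring
    have h1 := mul_lt_mul_of_pos_left hx.1 hν
    have h2 := mul_lt_mul_of_pos_left hx.2 hν
    refine Real.cos_pos_of_mem_Ioo ⟨?_, ?_⟩ <;> rw [e] <;> nlinarith
  have hsinpos : ∀ x, 0 < x → x < 1 → 0 < sin (pi * ν * x) / (pi * ν) := by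
    intro x hx hx1
    have e : pi * ν * x = pi * (ν * x) := by ring
    have h1 : 0 < ν * x := mul_pos hν hx
    have h2 : ν * x < 1 := by nlinarith
    have := Real.sin_pos_of_pos_of_lt_pi (x := pi * ν * x) (by positivity)
      (by rw [e]; nlinarith)
    positivity
  have p1 := mul_pos (hsinpos (α - t) (by linarith) (by linarith))
    (hcospos (β + 1 - α) (by rw [abs_lt]; constructor <;> linarith))
  have p2 := mul_pos (hsinpos (β + 1 - (β + α + t)) (by linarith) (by linarith))
    (hcospos (-(β + α)) (by rw [abs_lt]; constructor <;> linarith))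
  have p3 := mul_pos (hsinpos (α + t - (β + α)) (by linarith) (by linarith))
    (hcospos (1 - 2 * α) (by rw [abs_lt]; constructor <;> linarith))
  rw [show -(pi * ν * (t + α)) + pi * ν * (t + β + 1) = pi * ν * (β + 1 - α) by ring,
    show -(pi * ν * (β + α + t + (β + 1))) + pi * ν * (t + β + 1) = pi * ν * (-(β + α)) by ring,
    show -(pi * ν * (β + α + (α + t))) + pi * ν * (t + β + 1) = pi * ν * (1 - 2 * α) by ring] at h2
  linarith

end Zeros

end TwoIntervalGabor

end

noncomputable section

namespace TwoIntervalGabor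

/-! ### The short time Fourier transform for the window `χ_Ω` and its low zeros. -/

section Omega

variable {α β : ℝ}

theorem measurableSet_Omega (α β : ℝ) : MeasurableSet (Omega α β) :=
  measurableSet_Ico.union measurableSet_Ico

theorem volume_Omega (hα : 0 ≤ α) (hα1 : α ≤ 1) (hβ : 0 < β) : volume (Omega α β) = 1 := by
  rw [Omega, measure_union _ measurableSet_Ico, Real.volume_Ico, Real.volume_Ico,
    ← ENNReal.ofReal_add (by linarith) (by linarith), ← ENNReal.ofReal_one]
  · congr 1; ring
  · rw [Set.disjoint_left]
    rintro x ⟨_, h⟩ ⟨h', _⟩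
    linarith

/-- The three pieces are first with shifted first, second with shifted second, and second with
shifted first interval. The fourth combination is empty as `t ≥ 0`. -/
theorem mem_Omega_and_sub_mem_iff (hβ : 0 < β) {t : ℝ} (ht : 0 ≤ t)
    (x : ℝ) :
    x ∈ Omega α β ∧ x - t ∈ Omega α β ↔
      x ∈ Set.Ico t α ∪ (Set.Ico (β + α + t) (β + 1) ∪
        Set.Ico (max (β + α) t) (min (β + 1) (α + t))) := by
  simp only [Omega, Set.mem_union, Set.mem_Ico, max_le_iff, lt_min_iff]
  constructor
  · rintro ⟨⟨h1, h2⟩ | ⟨h1, h2⟩, ⟨h3, h4⟩ | ⟨h3, h4⟩⟩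
    · exact Or.inl ⟨by linarith, h2⟩
    · linarith
    · exact Or.inr (Or.inr ⟨⟨h1, by linarith⟩, h2, by linarith⟩)
    · exact Or.inr (Or.inl ⟨by linarith, h2⟩)
  · rintro (⟨h1, h2⟩ | ⟨h1, h2⟩ | ⟨⟨h1, h2⟩, h3, h4⟩)
    · exact ⟨Or.inl ⟨by linarith, h2⟩, Or.inl ⟨by linarith, by linarith⟩⟩
    · exact ⟨Or.inr ⟨by linarith, h2⟩, Or.inr ⟨by linarith, by linarith⟩⟩
    · exact ⟨Or.inr ⟨h1, h3⟩, Or.inl ⟨by linarith, by linarith⟩⟩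

theorem stft_Omega (hβ : 0 < β) {t : ℝ} (ht : 0 ≤ t) (ν : ℝ) :
    stft (chi (Omega α β)) (chi (Omega α β)) (t, ν) =
      expInt ν t α + (expInt ν (β + α + t) (β + 1) +
        expInt ν (max (β + α) t) (min (β + 1) (α + t))) := by
  set e : ℝ → ℂ := fun x => Complex.exp (-(2 * Real.pi * Complex.I * (x * ν : ℝ))) with he
  have hint : ∀ a b, IntegrableOn e (Set.Ico a b) := fun a b =>
    ((by fun_prop : Continuous e).integrableOn_Icc (a := a) (b := b)).mono_set
      Set.Ico_subset_Icc_self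
  have hfun : ∀ x, chi (Omega α β) x * conj (chi (Omega α β) (x - t)) * e x =
      (Set.Ico t α ∪ (Set.Ico (β + α + t) (β + 1) ∪
        Set.Ico (max (β + α) t) (min (β + 1) (α + t)))).indicator e x := fun x => by
    rw [conj_chi]
    have hm := mem_Omega_and_sub_mem_iff (α := α) hβ ht x
    by_cases hx : x ∈ Omega α β ∧ x - t ∈ Omega α β
    · rw [Set.indicator_of_mem (hm.1 hx)]
      simp [chi, hx.1, hx.2]
    · rw [Set.indicator_of_notMem (fun h => hx (hm.2 h))]
      rw [not_and_or] at hx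
      rcases hx with hx | hx <;> simp [chi, hx]
  have : stft (chi (Omega α β)) (chi (Omega α β)) (t, ν) =
      ∫ x, chi (Omega α β) x * conj (chi (Omega α β) (x - t)) * e x := rfl
  rw [this]
  simp_rw [hfun]
  rw [integral_indicator (measurableSet_Ico.union (measurableSet_Ico.union measurableSet_Ico)),
    setIntegral_union _ (measurableSet_Ico.union measurableSet_Ico) (hint _ _)
      ((hint _ _).union (hint _ _)),
    setIntegral_union _ measurableSet_Ico (hint _ _) (hint _ _)]
  · rfl
  · rw [Set.disjoint_left]
    rintro x ⟨h1, h2⟩ ⟨h3, h4⟩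
    have := lt_min_iff.1 h4
    linarith [this.2]
  · rw [Set.disjoint_left]
    rintro x ⟨h1, h2⟩ (⟨h3, h4⟩ | ⟨h3, h4⟩)
    · linarith
    · have := max_le_iff.1 h3
      linarith [this.1]

theorem stft_chi_neg_snd (S : Set ℝ) (t ν : ℝ) :
    stft (chi S) (chi S) (t, -ν) = conj (stft (chi S) (chi S) (t, ν)) := by
  rw [stft, stft, ← integral_conj]
  congr 1 with x
  simp only [map_mul, conj_chi, ← Complex.exp_conj, map_neg, Complex.conj_I, Complex.conj_ofReal,
    map_ofNat]
  push_cast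
  ring_nf

theorem stft_chi_abs_snd_eq_zero {S : Set ℝ} {t ν : ℝ} (h : stft (chi S) (chi S) (t, ν) = 0) :
    stft (chi S) (chi S) (t, |ν|) = 0 := by
  rcases abs_choice ν with h' | h' <;> rw [h']
  · exact h
  · rw [stft_chi_neg_snd, h, map_zero]

/-- At frequency zero the value is the length of the overlap, and half-open intervals with a point
in them have positive length. -/
theorem stft_Omega_zero_ne_zero (hβ : 0 < β) {t x : ℝ} (ht : 0 ≤ t)
    (hx : x ∈ Omega α β) (hxt : x - t ∈ Omega α β) :
    stft (chi (Omega α β)) (chi (Omega α β)) (t, 0) ≠ 0 := by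
  rw [stft_Omega hβ ht, expInt_zero, expInt_zero, expInt_zero]
  have h1 := le_max_right (α - t) 0
  have h2 := le_max_right (β + 1 - (β + α + t)) 0
  have h3 := le_max_right (min (β + 1) (α + t) - max (β + α) t) 0
  have h1' := le_max_left (α - t) 0
  have h2' := le_max_left (β + 1 - (β + α + t)) 0
  have h3' := le_max_left (min (β + 1) (α + t) - max (β + α) t) 0
  have : 0 < max (α - t) 0 + (max (β + 1 - (β + α + t)) 0 +
      max (min (β + 1) (α + t) - max (β + α) t) 0) := by
    rcases (mem_Omega_and_sub_mem_iff hβ ht x).1 ⟨hx, hxt⟩ with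
      ⟨h4, h5⟩ | ⟨h4, h5⟩ | ⟨h4, h5⟩ <;> linarith
  exact_mod_cast this.ne'

/-- A set over `Ω` whose difference set avoids the zeros of `V_g g` is an orthogonal packing
region. By symmetry only differences in a half-plane matter. -/
theorem isOrthPacking_Omega (hα : 0 ≤ α) (hα1 : α ≤ 1) (hβ : 0 < β) {D : Set (ℝ × ℝ)}
    (hD : ∀ p ∈ D, p.1 ∈ Omega α β)
    (h : ∀ p ∈ D, ∀ q ∈ D, q.1 ≤ p.1 → p.2 ≠ q.2 →
      stft (chi (Omega α β)) (chi (Omega α β)) (p.1 - q.1, |p.2 - q.2|) ≠ 0) :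
    IsOrthPacking (chi (Omega α β)) D := by
  have hpair : ∀ p ∈ D, ∀ q ∈ D, p ≠ q → q.1 ≤ p.1 →
      stft (chi (Omega α β)) (chi (Omega α β)) (p - q) ≠ 0 := by
    intro p hp q hq hpq hle h0
    have h0' := stft_chi_abs_snd_eq_zero (t := p.1 - q.1) (ν := p.2 - q.2) h0
    by_cases h2 : p.2 = q.2
    · rw [h2, sub_self, abs_zero] at h0'
      exact stft_Omega_zero_ne_zero hβ (sub_nonneg.2 hle) (hD p hp)
        (by simpa using hD q hq) h0'
    · exact h p hp q hq hle h2 h0'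
  intro p hp h0
  have : {x | x ∈ D ∧ x - p ∈ D} = ∅ := by
    rw [Set.eq_empty_iff_forall_notMem]
    rintro x ⟨hx, hxp⟩
    have hne : x ≠ x - p := fun h => hp (sub_eq_self.1 h.symm)
    rcases le_total (x - p).1 x.1 with hle | hle
    · exact hpair x hx _ hxp hne hle (by simpa using h0)
    · refine hpair _ hxp x hx hne.symm hle ?_
      have := stft_neg_eq_zero (measurableSet_Omega α β)
        (by simp [volume_Omega hα hα1 hβ]) h0
      simpa using this
  rw [this, measure_empty]

/-- The zeros of `V_g g` over `Ω - Ω` at low frequencies. -/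
theorem stft_Omega_eq_zero_cases (hα1 : α ≤ 1 / 2) (hβ : 0 < β) {t ν x : ℝ} (ht : 0 ≤ t)
    (hx : x ∈ Omega α β) (hxt : x - t ∈ Omega α β) (hν : 0 < ν) (hν2 : ν < 2)
    (hν3 : ν * (1 - 2 * α) < 1) (hν4 : ν * (1 - α - β) < 1)
    (hν5 : α ≤ β ∨ (α < 1 / 2 ∧ ν < 1))
    (h0 : stft (chi (Omega α β)) (chi (Omega α β)) (t, ν) = 0) :
    (t < α ∧ (α = 1 / 2 ∨ ν * (1 - 2 * t) = 1) ∧ ∃ k : ℤ, ν * (2 * β + 1) = 2 * k + 1) ∨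
    (t = (1 + β - α) / 2 ∧ β < 1 - α ∧ 1 - 3 * α ≤ β ∧ ∃ k : ℤ, ν * (β + 1 - α) = 2 * k + 1) ∨
    (t = 1 - 2 * α ∧ 0 < α ∧ β < 1 - 3 * α ∧ ∃ k : ℤ, ν * (2 * (α + β)) = 2 * k + 1) := by
  have hmem := (mem_Omega_and_sub_mem_iff hβ ht x).1 ⟨hx, hxt⟩
  rw [stft_Omega hβ ht] at h0
  rcases lt_or_ge t α with htα | htα
  · rcases le_or_gt t β with htβ | htβ
    · rw [expInt_of_le ((min_le_right _ _).trans ((by linarith : α + t ≤ β + α).trans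
        (le_max_left _ _))), add_zero] at h0
      obtain ⟨hc, k, hk⟩ := odd_of_expInt_add_eq_zero hν htα (by linarith) (by nlinarith)
        (by rw [abs_sub_comm, abs_of_nonneg (by linarith)]; nlinarith) h0
      refine Or.inl ⟨htα, ?_, k, by linear_combination hk⟩
      rcases hc with hc | hc
      · left; linarith
      · right; linear_combination hc
    -- For `β < t < α` all three pieces are nonempty.
    · rw [max_eq_left (by linarith), min_eq_right (by linarith), ← add_assoc] at h0
      rcases hν5 with h5 | ⟨h5, h6⟩
      · linarith
      · exact absurd h0 (expInt_three_ne_zero hβ htβ htα h5 hν h6)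
  rw [expInt_of_le htα, zero_add] at h0
  -- From here the piece inside the first interval is gone. Two pieces can cancel only if their
  -- lengths agree, as `hν4` keeps the total length times `ν` below one; this pins down `t`. A
  -- single piece is too short to have a zero.
  rcases lt_or_ge t (1 - α) with ht1 | ht1
  · have hs2 : expInt ν (β + α + t) (β + 1) ≠ 0 :=
      expInt_ne_zero hν (by linarith) (by nlinarith)
    by_cases h3 : β < t ∧ 0 < α
    · rw [min_eq_right (by linarith), add_comm] at h0
      rcases le_or_gt t (α + β) with hle | hlt
      · rw [max_eq_left (by linarith)] at h0
        obtain ⟨hc, k, hk⟩ := odd_of_expInt_add_eq_zero hν (by linarith) (by linarith)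
          (by nlinarith) (by
            refine lt_of_le_of_lt (mul_le_mul_of_nonneg_left ?_ hν.le) hν4
            rw [abs_le]; constructor <;> linarith) h0
        have hc' : α + t - (β + α) = β + 1 - (β + α + t) :=
          hc.resolve_right fun h => by nlinarith
        exact Or.inr (Or.inl ⟨by linarith, by linarith, by linarith, k, by linear_combination hk⟩)
      · rw [max_eq_right (by linarith)] at h0
        have hlen : ν * (1 - t) < 1 :=
          lt_of_le_of_lt (mul_le_mul_of_nonneg_left (by linarith) hν.le) hν4
        obtain ⟨hc, k, hk⟩ := odd_of_expInt_add_eq_zero hν (by linarith) (by linarith)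
          (by nlinarith) (by
            refine lt_of_le_of_lt (mul_le_mul_of_nonneg_left ?_ hν.le) hlen
            rw [abs_le]; constructor <;> linarith) h0
        have hc' : α + t - t = β + 1 - (β + α + t) :=
          hc.resolve_right fun h => by nlinarith
        refine Or.inr (Or.inr ⟨by linarith, h3.2, by linarith, k, ?_⟩)
        linear_combination hk + ν * hc'
    · refine absurd h0 ?_
      rw [expInt_of_le (ν := ν) (a := max (β + α) t), add_zero]
      · exact hs2
      · refine (min_le_right _ _).trans ?_
        rcases not_and_or.1 h3 with h | h
        · exact (by linarith : α + t ≤ β + α).trans (le_max_left _ _)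
        · exact (by linarith : α + t ≤ t).trans (le_max_right _ _)
  · rw [expInt_of_le (by linarith), zero_add] at h0
    have hlt : max (β + α) t < min (β + 1) (α + t) := by
      rcases hmem with ⟨h4, h5⟩ | ⟨h4, h5⟩ | ⟨h4, h5⟩ <;> linarith
    refine absurd h0 (expInt_ne_zero hν hlt ?_)
    have h1 := min_le_right (β + 1) (α + t)
    have h2 := le_max_right (β + α) t
    nlinarith

end Omega

end TwoIntervalGabor

end

noncomputable section

namespace TwoIntervalGabor

/-! ### Packing regions for each range of the parameters. -/

section Regions

variable {α β : ℝ}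

theorem int_eq_zero_of_odd_lt_three {y : ℝ} {k : ℤ} (hk : y = 2 * k + 1) (h0 : 0 < y)
    (h3 : y < 3) : k = 0 := by
  have h1 : (-1 : ℝ) < k := by linarith
  have h2 : (k : ℝ) < 1 := by linarith
  have h1' : -1 < k := by exact_mod_cast h1
  have h2' : k < 1 := by exact_mod_cast h2
  omega

theorem one_le_of_odd_pos {y : ℝ} {k : ℤ} (hk : y = 2 * k + 1) (h0 : 0 < y) : 1 ≤ y := by
  have h1 : (-1 : ℝ) < k := by linarith
  have h1' : -1 < k := by exact_mod_cast h1
  have h2 : (0 : ℝ) ≤ k := by exact_mod_cast (by omega : 0 ≤ k)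
  linarith

theorem abs_sub_lt_of_mem_Ico {ξ η h : ℝ} (hξ : ξ ∈ Set.Ico 0 h) (hη : η ∈ Set.Ico 0 h) :
    |ξ - η| < h := by
  rw [abs_lt]
  constructor <;> linarith [hξ.1, hξ.2, hη.1, hη.2]

/-- Outside of the two exceptional parameter ranges, `Ω × [0,1)` is an orthogonal packing region
when `α < 1/2`. -/
theorem isOrthPacking_Omega_prod_unit (hα : 0 ≤ α) (hα1 : α < 1 / 2) (hβ : 0 < β)
    (h1 : ¬ (α < β ∧ β < 1 - α ∧ 1 - 3 * α ≤ β))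
    (h2 : ¬ (0 < α ∧ β < 1 - 3 * α ∧ 1 / 2 < α + β)) :
    IsOrthPacking (chi (Omega α β)) (Omega α β ×ˢ Set.Ico (0 : ℝ) 1) := by
  refine isOrthPacking_Omega hα (by linarith) hβ (fun p hp => hp.1) ?_
  rintro p ⟨hp1, hp2⟩ q ⟨hq1, hq2⟩ hle hne h0
  have hν : 0 < |p.2 - q.2| := abs_pos.2 (sub_ne_zero.2 hne)
  have hν1 : |p.2 - q.2| < 1 := abs_sub_lt_of_mem_Ico hp2 hq2
  set ν := |p.2 - q.2|
  rcases stft_Omega_eq_zero_cases hα1.le hβ (sub_nonneg.2 hle) hp1 (by simpa using hq1) hν (by linarith)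
    (by nlinarith) (by nlinarith) (Or.inr ⟨hα1, hν1⟩) h0 with
    ⟨_, hA | hA, _⟩ | ⟨_, hB1, hB2, k, hk⟩ | ⟨_, hC1, hC2, k, hk⟩
  · linarith
  · nlinarith
  · have := one_le_of_odd_pos hk (mul_pos hν (by linarith))
    exact h1 ⟨by nlinarith, hB1, hB2⟩
  · have := one_le_of_odd_pos hk (mul_pos hν (by linarith))
    exact h2 ⟨hC1, hC2, by nlinarith⟩

/-- At a frequency below `3 / (2 * β + 1)`, the first alternative of `stft_Omega_eq_zero_cases` does not occur
when `α < 1 / 2`. -/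
theorem false_of_low_frequency (hα1 : α < 1 / 2) (hβ : 0 < β) {t ν : ℝ} (ht : 0 ≤ t) (hν : 0 < ν)
    (hν3 : ν * (2 * β + 1) < 3) (h : α = 1 / 2 ∨ ν * (1 - 2 * t) = 1)
    (hk : ∃ k : ℤ, ν * (2 * β + 1) = 2 * k + 1) : False := by
  obtain ⟨k, hk⟩ := hk
  have hk0 := int_eq_zero_of_odd_lt_three hk (by positivity) hν3
  rw [hk0] at hk
  push_cast at hk
  rcases h with h | h
  · linarith
  · nlinarith

/-- In the first exceptional parameter range there is a zero of `V_g g` inside the difference set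
of `Ω × [0,1)`, at the single time shift `(1 + β - α) / 2`. Removing a short interval from `Ω`
avoids this shift and leaves room for more than the lost area at higher frequencies. -/
theorem exists_large_isOrthPacking_of_le (hα1 : α < 1 / 2) (hβ : 0 < β) (h1 : α < β)
    (h2 : β < 1 - α) (h3 : 1 - 3 * α ≤ β) :
    ∃ D : Set (ℝ × ℝ), MeasurableSet D ∧ 1 < volume D ∧ IsOrthPacking (chi (Omega α β)) D := by
  have hα : 0 < α := by linarith
  have hs : 0 < 1 + α + β := by linarith
  have e1 : 2 / (1 + α + β) < 3 / (2 * β + 1) := by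
    rw [div_lt_div_iff₀ hs (by linarith)]; linarith
  have e2 : 2 / (1 + α + β) < 1 / (1 - 2 * α) := by
    rw [div_lt_div_iff₀ hs (by linarith)]; linarith
  have e3 : 2 / (1 + α + β) < 1 / (1 - α - β) := by
    rw [div_lt_div_iff₀ hs (by linarith)]; linarith
  -- The trimmed base has length `(1 + α + β) / 2`, so a height above `2 / (1 + α + β)` gives area
  -- greater than one. The upper bounds are the frequency conditions of the zero analysis.
  obtain ⟨h, hh0, hh⟩ := exists_between (lt_min e1 (lt_min e2 e3))
  rw [lt_min_iff, lt_min_iff, lt_div_iff₀ (by linarith), lt_div_iff₀ (by linarith),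
    lt_div_iff₀ (by linarith)] at hh
  obtain ⟨hh1, hh2, hh3⟩ := hh
  rw [div_lt_iff₀ hs] at hh0
  have hhpos : 0 < h := by nlinarith
  have hh4 : h < 2 := by nlinarith
  set t₀ := (1 + β - α) / 2 with ht₀
  refine ⟨(Set.Ico 0 α ∪ Set.Ico (α + t₀) (β + 1)) ×ˢ Set.Ico 0 h,
    (measurableSet_Ico.union measurableSet_Ico).prod measurableSet_Ico, ?_, ?_⟩
  · rw [Measure.volume_eq_prod, Measure.prod_prod, measure_union _ measurableSet_Ico,
      Real.volume_Ico, Real.volume_Ico, Real.volume_Ico,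
      ← ENNReal.ofReal_add (by linarith) (by linarith), ← ENNReal.ofReal_mul (by linarith),
      ← ENNReal.ofReal_one]
    · rw [ENNReal.ofReal_lt_ofReal_iff_of_nonneg zero_le_one]
      rw [ht₀]; linarith
    · rw [Set.disjoint_left]
      rintro x ⟨_, h⟩ ⟨h', _⟩
      linarith
  · have hsub : ∀ x ∈ Set.Ico 0 α ∪ Set.Ico (α + t₀) (β + 1), x ∈ Omega α β := by
      rintro x (hx | hx)
      · exact Or.inl hx
      · exact Or.inr ⟨by linarith [hx.1], hx.2⟩
    refine isOrthPacking_Omega hα.le (by linarith) hβ (fun p hp => hsub _ hp.1) ?_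
    rintro p ⟨hp1, hp2⟩ q ⟨hq1, hq2⟩ hle hne h0
    have hν : 0 < |p.2 - q.2| := abs_pos.2 (sub_ne_zero.2 hne)
    have hν1 : |p.2 - q.2| < h := abs_sub_lt_of_mem_Ico hp2 hq2
    set ν := |p.2 - q.2|
    rcases stft_Omega_eq_zero_cases hα1.le hβ (sub_nonneg.2 hle) (hsub _ hp1) (by simpa using hsub _ hq1) hν
      (by linarith) (by nlinarith) (by nlinarith) (Or.inl h1.le) h0 with
      ⟨_, hA, hk⟩ | ⟨hB, _⟩ | ⟨_, _, hC, _⟩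
    · exact false_of_low_frequency hα1 hβ (sub_nonneg.2 hle) hν (by nlinarith) hA hk
    -- Differences within one interval of the trimmed base are below `t₀`, and those across the gap
    -- exceed `t₀`.
    · rcases hp1 with ⟨hp3, hp4⟩ | ⟨hp3, hp4⟩ <;> rcases hq1 with ⟨hq3, hq4⟩ | ⟨hq3, hq4⟩ <;>
        linarith
    · linarith

/-- In the second exceptional parameter range the single bad time shift is `1 - 2 * α`, and the
frequency range is lowered on the part `K` of `Ω` that meets a translate of `Ω` by it. -/
theorem exists_large_isOrthPacking_of_lt (hα : 0 < α) (hβ : 0 < β) (h1 : β < 1 - 3 * α)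
    (h2 : 1 / 2 < α + β) :
    ∃ D : Set (ℝ × ℝ), MeasurableSet D ∧ 1 < volume D ∧ IsOrthPacking (chi (Omega α β)) D := by
  have hα1 : α < 1 / 4 := by linarith
  obtain ⟨h, hh⟩ : ∃ h, h = 1 / (1 - 2 * α) := ⟨_, rfl⟩
  -- `ν₀` is the least positive frequency of a zero at the shift `1 - 2 * α`; it is below `1` as
  -- `1/2 < α + β`.
  obtain ⟨ν₀, hν₀⟩ : ∃ ν₀, ν₀ = 1 / (2 * (α + β)) := ⟨_, rfl⟩
  rw [eq_div_iff (by linarith)] at hh hν₀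
  have hh0 : 0 < h := by nlinarith
  have hν₀0 : 0 < ν₀ := by nlinarith
  have hν₀h : ν₀ < h := by nlinarith
  have hh2 : h < 2 := by nlinarith
  have hh3 : h * (2 * β + 1) < 3 := by nlinarith
  set K : Set ℝ := (Set.Ico 0 α ∪ Set.Ico (1 - 2 * α) (1 - α)) ∪
    (Set.Ico (β + α) (β + 2 * α) ∪ Set.Ico (1 + β - α) (1 + β)) with hK
  have hKm : MeasurableSet K :=
    (measurableSet_Ico.union measurableSet_Ico).union (measurableSet_Ico.union measurableSet_Ico)
  have hKv : volume K ≤ ENNReal.ofReal (4 * α) := by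
    refine (measure_union_le _ _).trans ((add_le_add (measure_union_le _ _)
      (measure_union_le _ _)).trans ?_)
    simp only [Real.volume_Ico]
    rw [← ENNReal.ofReal_add (by linarith) (by linarith),
      ← ENNReal.ofReal_add (by linarith) (by linarith),
      ← ENNReal.ofReal_add (by linarith) (by linarith)]
    exact ENNReal.ofReal_le_ofReal (by linarith)
  have hR : ENNReal.ofReal (1 - 4 * α) ≤ volume (Omega α β \ K) := by
    rw [ENNReal.ofReal_sub _ (by linarith), ENNReal.ofReal_one,
      ← volume_Omega (β := β) hα.le (by linarith) hβ]
    exact (tsub_le_tsub_left hKv _).trans le_measure_sdiff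
  refine ⟨Omega α β ×ˢ Set.Ico 0 ν₀ ∪ (Omega α β \ K) ×ˢ Set.Ico ν₀ h,
    ((measurableSet_Omega α β).prod measurableSet_Ico).union
      (((measurableSet_Omega α β).diff hKm).prod measurableSet_Ico), ?_, ?_⟩
  · rw [measure_union _ (((measurableSet_Omega α β).diff hKm).prod measurableSet_Ico),
      Measure.volume_eq_prod, Measure.prod_prod, Measure.prod_prod,
      volume_Omega hα.le (by linarith) hβ, one_mul, Real.volume_Ico, Real.volume_Ico]
    · refine lt_of_lt_of_le ?_ (add_le_add le_rfl (mul_le_mul' hR le_rfl))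
      rw [← ENNReal.ofReal_mul (by linarith), ← ENNReal.ofReal_add (by linarith)
        (mul_nonneg (by linarith) (by linarith)), ← ENNReal.ofReal_one,
        ENNReal.ofReal_lt_ofReal_iff_of_nonneg zero_le_one]
      -- This is `β < 1 - 3 * α`. The area is at least `4αν₀ + (1 - 4α)h`, hence greater than `(1 -
      -- 2α)h = 1`.
      have : h < 2 * ν₀ := by nlinarith
      nlinarith
    · rw [Set.disjoint_left]
      rintro x ⟨_, _, h⟩ ⟨_, h', _⟩
      linarith
  · refine isOrthPacking_Omega hα.le (by linarith) hβ
      (fun p hp => hp.elim (fun h => h.1) fun h => h.1.1) ?_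
    have hmem : ∀ p ∈ Omega α β ×ˢ Set.Ico 0 ν₀ ∪ (Omega α β \ K) ×ˢ Set.Ico ν₀ h,
        p.1 ∈ Omega α β ∧ p.2 ∈ Set.Ico 0 h ∧ (p.1 ∈ K → p.2 ∈ Set.Ico 0 ν₀) := by
      rintro p (⟨hp1, hp2⟩ | ⟨hp1, hp2⟩)
      · exact ⟨hp1, ⟨hp2.1, hp2.2.trans hν₀h⟩, fun _ => hp2⟩
      · exact ⟨hp1.1, ⟨hν₀0.le.trans hp2.1, hp2.2⟩, fun h => absurd h hp1.2⟩
    intro p hp q hq hle hne h0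
    obtain ⟨hp1, hp2, hp3⟩ := hmem p hp
    obtain ⟨hq1, hq2, hq3⟩ := hmem q hq
    have hν : 0 < |p.2 - q.2| := abs_pos.2 (sub_ne_zero.2 hne)
    have hν1 : |p.2 - q.2| < h := abs_sub_lt_of_mem_Ico hp2 hq2
    have hν2 : p.1 ∈ K → q.1 ∈ K → |p.2 - q.2| < ν₀ := fun hpK hqK =>
      abs_sub_lt_of_mem_Ico (hp3 hpK) (hq3 hqK)
    set ν := |p.2 - q.2|
    rcases stft_Omega_eq_zero_cases (by linarith) hβ (sub_nonneg.2 hle) hp1 (by simpa using hq1) hν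
      (by linarith) (by nlinarith) (by nlinarith) (Or.inl (by linarith)) h0 with
      ⟨_, hA, hk⟩ | ⟨_, _, hB, _⟩ | ⟨hC, _, _, k, hk⟩
    · exact false_of_low_frequency (by linarith) hβ (sub_nonneg.2 hle) hν (by nlinarith) hA hk
    · linarith
    · have hpq : p.1 ∈ K ∧ q.1 ∈ K := by
        rcases hp1 with ⟨hp3, hp4⟩ | ⟨hp3, hp4⟩ <;> rcases hq1 with ⟨hq3, hq4⟩ | ⟨hq3, hq4⟩
        · linarith
        · linarith
        · exact ⟨Or.inl (Or.inr ⟨by linarith, by linarith⟩), Or.inl (Or.inl ⟨hq3, hq4⟩)⟩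
        · exact ⟨Or.inr (Or.inr ⟨by linarith, by linarith⟩),
            Or.inr (Or.inl ⟨hq3, by linarith⟩)⟩
      have := hν2 hpq.1 hpq.2
      have := one_le_of_odd_pos hk (by positivity)
      nlinarith

/-! ### The case `α = 1/2`. -/

/-- The frequency part of `region (1 / 2) β`. -/
def halfFreq (β : ℝ) : Set ℝ := fullBlocks β ∪ thinBlock β

/-- In units of `1 / (2β + 1)` every block, also the thin one, lies in some `[2k, 2k + 1)`. The
bound `ξ < 2` keeps differences in the range of `stft_Omega_eq_zero_cases`. -/
theorem exists_nat_of_mem_halfFreq (hβ : 0 < β) {ξ : ℝ} (h : ξ ∈ halfFreq β) :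
    ∃ k : ℕ, 2 * (k : ℝ) ≤ ξ * (2 * β + 1) ∧ ξ * (2 * β + 1) < 2 * k + 1 ∧ 0 ≤ ξ ∧ ξ < 2 := by
  have hs : 0 < 2 * β + 1 := by linarith
  rcases h with h | ⟨h1, h2⟩
  · simp only [fullBlocks, Set.mem_iUnion, Finset.mem_range, exists_prop] at h
    obtain ⟨k, hk, h1, h2⟩ := h
    rw [div_le_iff₀ hs] at h1
    rw [lt_div_iff₀ hs] at h2
    have hk' : (k : ℝ) ≤ 2 * β :=
      (Nat.cast_le.2 (Nat.lt_succ_iff.1 hk)).trans (Nat.floor_le (by linarith))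
    refine ⟨k, h1, h2, ?_, ?_⟩
    · have : 0 ≤ ξ * (2 * β + 1) := le_trans (by positivity) h1
      exact nonneg_of_mul_nonneg_left this hs
    · nlinarith
  · rw [div_le_iff₀ hs] at h1
    rw [lt_div_iff₀ hs] at h2
    have hfl : 0 ≤ ⌊2 * β⌋ := Int.floor_nonneg.2 (by linarith)
    obtain ⟨n, hn⟩ := Int.eq_ofNat_of_zero_le hfl
    have hfr := Int.fract_lt_one (2 * β)
    have hsum := Int.floor_add_fract (2 * β)
    have hfr0 := Int.fract_nonneg (2 * β)
    rw [hn] at h1 h2 hsum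
    push_cast at h1 h2 hsum
    refine ⟨n + 1, by push_cast; linarith, by push_cast; linarith, ?_, ?_⟩
    · have : 0 ≤ ξ * (2 * β + 1) := le_trans (by positivity) h1
      exact nonneg_of_mul_nonneg_left this hs
    · have : ξ * (2 * β + 1) < 2 * (2 * β + 1) := by nlinarith
      nlinarith

theorem measurableSet_fullBlocks (β : ℝ) : MeasurableSet (fullBlocks β) :=
  Finset.measurableSet_biUnion _ fun _ _ => measurableSet_Ico

theorem volume_fullBlocks (hβ : 0 < β) :
    volume (fullBlocks β) = ENNReal.ofReal ((⌊2 * β⌋₊ + 1) / (2 * β + 1)) := by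
  have hs : 0 < 2 * β + 1 := by linarith
  rw [fullBlocks, measure_biUnion_finset]
  · have : ∀ k : ℕ, volume (Set.Ico (2 * (k : ℝ) / (2 * β + 1)) ((2 * (k : ℝ) + 1) / (2 * β + 1)))
        = ENNReal.ofReal (1 / (2 * β + 1)) := fun k => by
      rw [Real.volume_Ico, ← sub_div]; congr 2; ring
    simp_rw [this]
    rw [Finset.sum_const, Finset.card_range, nsmul_eq_mul, ← ENNReal.ofReal_natCast,
      ← ENNReal.ofReal_mul (by positivity)]
    congr 1
    push_cast
    ring
  · intro i _ j _ hij
    rw [Function.onFun, Set.disjoint_left]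
    rintro x ⟨h1, h2⟩ ⟨h3, h4⟩
    rw [div_le_iff₀ hs] at h1 h3
    rw [lt_div_iff₀ hs] at h2 h4
    have h5 : (i : ℝ) < j + 1 := by linarith
    have h6 : (j : ℝ) < i + 1 := by linarith
    have h5' : i < j + 1 := by exact_mod_cast h5
    have h6' : j < i + 1 := by exact_mod_cast h6
    omega
  · exact fun _ _ => measurableSet_Ico

/-- In the same units the lengths add up to `⌊2β⌋ + 1 + {2β} = 2β + 1`. -/
theorem volume_halfFreq (hβ : 0 < β) : volume (halfFreq β) = 1 := by
  have hs : 0 < 2 * β + 1 := by linarith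
  have hfl : (⌊2 * β⌋ : ℝ) = (⌊2 * β⌋₊ : ℝ) := by
    rw [← Int.cast_natCast, Int.natCast_floor_eq_floor (by linarith)]
  have hfr := Int.floor_add_fract (2 * β)
  rw [halfFreq, thinBlock, measure_union _ measurableSet_Ico, volume_fullBlocks hβ,
    Real.volume_Ico, ← sub_div, ← ENNReal.ofReal_add (by positivity), ← ENNReal.ofReal_one]
  · congr 1
    rw [← add_div, div_eq_one_iff_eq hs.ne', ← hfl]
    linarith
  · refine div_nonneg ?_ hs.le
    linarith [Int.fract_nonneg (2 * β)]
  · rw [Set.disjoint_left]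
    intro x hx hx'
    simp only [fullBlocks, Set.mem_iUnion, Finset.mem_range, exists_prop] at hx
    obtain ⟨k, hk, h1, h2⟩ := hx
    have h3 := hx'.1
    rw [div_le_iff₀ hs, hfl] at h3
    rw [lt_div_iff₀ hs] at h2
    have : (k : ℝ) ≤ (⌊2 * β⌋₊ : ℝ) := by exact_mod_cast Nat.lt_succ_iff.1 hk
    linarith

theorem fullBlocks_eq_halfFreq {n : ℕ} (hn : β = (n : ℝ) / 2) : fullBlocks β = halfFreq β := by
  have : Int.fract (2 * β) = 0 := by
    rw [hn, mul_div_cancel₀ _ two_ne_zero, Int.fract_natCast]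
  rw [halfFreq, thinBlock, this, add_zero, Set.Ico_self, Set.union_empty]

/-- For `α = 1/2 ≤ β` only the first kind of zero survives, at odd multiples of `1 / (2β + 1)`.
Frequency differences of the blocks, in these units, lie strictly between consecutive odd integers.
-/
theorem isOrthPacking_Omega_prod_halfFreq (hβ : 1 / 2 ≤ β) :
    IsOrthPacking (chi (Omega (1 / 2) β)) (Omega (1 / 2) β ×ˢ halfFreq β) := by
  have hβ0 : 0 < β := by linarith
  refine isOrthPacking_Omega (by norm_num) (by norm_num) hβ0 (fun p hp => hp.1) ?_
  rintro p ⟨hp1, hp2⟩ q ⟨hq1, hq2⟩ hle hne h0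
  have hν : 0 < |p.2 - q.2| := abs_pos.2 (sub_ne_zero.2 hne)
  obtain ⟨m, hm1, hm2, hm3, hm4⟩ := exists_nat_of_mem_halfFreq hβ0 hp2
  obtain ⟨n, hn1, hn2, hn3, hn4⟩ := exists_nat_of_mem_halfFreq hβ0 hq2
  have hν2 : |p.2 - q.2| < 2 := abs_sub_lt_of_mem_Ico ⟨hm3, hm4⟩ ⟨hn3, hn4⟩
  rcases stft_Omega_eq_zero_cases le_rfl hβ0 (sub_nonneg.2 hle) hp1 (by simpa using hq1) hν hν2
    (by norm_num) (by nlinarith) (Or.inl hβ) h0 with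
    ⟨_, _, k, hk⟩ | ⟨_, hB, _⟩ | ⟨_, _, hC, _⟩
  · rcases abs_choice (p.2 - q.2) with he | he <;> rw [he] at hk
    · have h1 : ((2 * m - 2 * n - 1 : ℤ) : ℝ) < ((2 * k + 1 : ℤ) : ℝ) := by push_cast; linarith
      have h2 : ((2 * k + 1 : ℤ) : ℝ) < ((2 * m - 2 * n + 1 : ℤ) : ℝ) := by push_cast; linarith
      have h1' := Int.cast_lt.1 h1
      have h2' := Int.cast_lt.1 h2
      omega
    · have h1 : ((2 * n - 2 * m - 1 : ℤ) : ℝ) < ((2 * k + 1 : ℤ) : ℝ) := by push_cast; linarith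
      have h2 : ((2 * k + 1 : ℤ) : ℝ) < ((2 * n - 2 * m + 1 : ℤ) : ℝ) := by push_cast; linarith
      have h1' := Int.cast_lt.1 h1
      have h2' := Int.cast_lt.1 h2
      omega
  · linarith
  · linarith

theorem region_of_lt (h : α < 1 / 2) : region α β = Omega α β ×ˢ Set.Ico (0 : ℝ) 1 :=
  if_pos h

theorem region_half (β : ℝ) : region (1 / 2) β = Omega (1 / 2) β ×ˢ halfFreq β := by
  rw [region, if_neg (lt_irrefl _)]
  split_ifs with h
  · obtain ⟨n, hn⟩ := h
    rw [fullBlocks_eq_halfFreq hn]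
  · rfl

end Regions

end TwoIntervalGabor

end

open TwoIntervalGabor in
theorem mainTheorem1 (α β : ℝ) (hα : 0 ≤ α) (hβ : 0 < β)
    (hαβ : α < 1 / 2 ∨ (α = 1 / 2 ∧ 1 / 2 ≤ β)) (Λ : Set (ℝ × ℝ)) :
    TwoIntervalGabor.IsGaborONB (TwoIntervalGabor.chi (TwoIntervalGabor.Omega α β)) Λ ↔
      Λ - Λ ⊆
          TwoIntervalGabor.zeroSet (TwoIntervalGabor.chi (TwoIntervalGabor.Omega α β)) ∪ {0} ∧
        TwoIntervalGabor.Tiles (TwoIntervalGabor.region α β) Λ := by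
  have hS := measurableSet_Omega α β
  have hS1 : volume (Omega α β) = 1 :=
    volume_Omega hα (by rcases hαβ with h | ⟨h, -⟩ <;> linarith) hβ
  rcases hαβ with hα1 | ⟨rfl, hβ1⟩
  · rw [region_of_lt hα1]
    have hDm : MeasurableSet (Omega α β ×ˢ Set.Ico (0 : ℝ) 1) := hS.prod measurableSet_Ico
    have hD1 : volume (Omega α β ×ˢ Set.Ico (0 : ℝ) 1) = 1 := by
      rw [Measure.volume_eq_prod, Measure.prod_prod, hS1, Real.volume_Ico]
      simp
    -- In the two exceptional ranges `Ω × [0,1)` is not used as a packing region; both sides of the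
    -- equivalence are false.
    by_cases h1 : α < β ∧ β < 1 - α ∧ 1 - 3 * α ≤ β
    · obtain ⟨D', hD', hv, hp⟩ := exists_large_isOrthPacking_of_le hα1 hβ h1.1 h1.2.1 h1.2.2
      exact isGaborONB_iff_of_one_lt_volume hS hS1 hDm hD1 hD' hv hp
    by_cases h2 : 0 < α ∧ β < 1 - 3 * α ∧ 1 / 2 < α + β
    · obtain ⟨D', hD', hv, hp⟩ := exists_large_isOrthPacking_of_lt h2.1 hβ h2.2.1 h2.2.2
      exact isGaborONB_iff_of_one_lt_volume hS hS1 hDm hD1 hD' hv hp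
    exact isGaborONB_iff_of_isOrthPacking hS hS1 hDm hD1
      (isOrthPacking_Omega_prod_unit hα hα1 hβ h1 h2)
  · rw [region_half]
    refine isGaborONB_iff_of_isOrthPacking hS hS1
      (hS.prod ((measurableSet_fullBlocks β).union measurableSet_Ico)) ?_
      (isOrthPacking_Omega_prod_halfFreq hβ1)
    rw [Measure.volume_eq_prod, Measure.prod_prod, hS1, volume_halfFreq hβ, one_mul]
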